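/- Let $R$ be a commutative Noetherian ring, let $r\ge 1$, let $I_1,\dots,I_r$ be ideals of $R$, and write $\mathbf I^{\underline n}=I_1^{n_1}\cdots I_r^{n_r}$ for $\underline n=(n_1,\dots,n_r)\in\mathbb N^r$. "For all $\underline n\gg 0$" means: for all $\underline n\ge\underline c$ (componentwise), for some $\underline c\in\mathbb N^r$. Let $T$ be an $R$-module, and let $U,V,W$ be finitely generated submodules of $T$ with $W\subseteq V$. Set $$L_{\underline n}:=(U+\mathbf I^{\underline n}V)/\mathbf I^{\underline n}W\qquad(\underline n\in\mathbb N^r),$$ and assume that the length $\lambda_R(L_{\underline n})$ is finite for all $\underline n\gg 0$. Then there exists a polynomial $P$ in $r$ variables over $\mathbb Q$ such that $$\lambda_R(L_{\underline n})=P(\underline n)\quad\text{for all }\underline n\gg 0.$$ Furthermore, if $R$ is a local ring with maximal ideal $\mathfrak m$, then for every ideal $J\subseteq\operatorname{ann}_R(V)$, $$\deg(P)\le\max\{\dim(U),\ \ell_{R/J}(\mathbf I)-r\}.$$ Here $\deg$ is the total degree, $\dim(U)$ is the Krull dimension of the module $U$, and, for a finitely generated $R$-module $M$, $\ell_M(\mathbf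 I)$ is the Krull dimension of the module $\bigoplus_{\underline n\in\mathbb N^r}\mathbf I^{\underline n}M/\mathfrak m\mathbf I^{\underline n}M$ over the multigraded Rees ring $\mathcal R(\mathbf I)=\bigoplus_{\underline n\in\mathbb N^r}\mathbf I^{\underline n}$. By convention the zero polynomial has degree $-\infty$ and the zero module has dimension $-\infty$. -/

import Mathlib

open DirectSum

universe u v

noncomputable section

variable {R : Type u} [CommRing R] {r : ℕ}

/-- The ideal `𝐈ⁿ = I₁^{n₁} ⋯ I_r^{n_r}` attached to ideals `I₁, …, I_r` and a multi-index. -/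
def idealPow (I : Fin r → Ideal R) (n : Fin r → ℕ) : Ideal R :=
  ∏ i, I i ^ n i

theorem idealPow_zero (I : Fin r → Ideal R) : idealPow I 0 = 1 := by
  simp [idealPow]

theorem idealPow_add (I : Fin r → Ideal R) (m n : Fin r → ℕ) :
    idealPow I (m + n) = idealPow I m * idealPow I n := by
  simp [idealPow, pow_add, Finset.prod_mul_distrib]

instance idealPow_gradedMonoid (I : Fin r → Ideal R) :
    SetLike.GradedMonoid (idealPow I) where
  one_mem := by simp [idealPow_zero]
  mul_mem i j a b ha hb := by
    rw [idealPow_add]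
    exact Ideal.mul_mem_mul ha hb

/-- The multigraded Rees ring `ℛ(𝐈) = ⨁ₙ 𝐈ⁿ`, the sum being over all `n ∈ ℕ^r`. -/
abbrev MultiRees (I : Fin r → Ideal R) : Type u :=
  ⨁ n : Fin r → ℕ, ↥(idealPow I n)

section Fiber

variable (I : Fin r → Ideal R) (M : Type v) [AddCommGroup M] [Module R M]

/-- The submodule `𝐈ⁿ M` of `M`. -/
abbrev powSub (n : Fin r → ℕ) : Submodule R M :=
  idealPow I n • (⊤ : Submodule R M)

variable {M} in
theorem powSub_smul_mem {i j : Fin r → ℕ} {a : R} {x : M} (ha : a ∈ idealPow I i)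
    (hx : x ∈ powSub I M j) : a • x ∈ powSub I M (i + j) := by
  rw [powSub, idealPow_add, mul_smul]
  exact Submodule.smul_mem_smul ha hx

/-- Multiplication by `a ∈ 𝐈ⁱ` as a map `𝐈ʲ M → 𝐈ⁱ⁺ʲ M`. -/
def powSubMul {i j : Fin r → ℕ} (a : ↥(idealPow I i)) :
    ↥(powSub I M j) →ₗ[R] ↥(powSub I M (i + j)) where
  toFun x := ⟨(a : R) • (x : M), powSub_smul_mem I a.2 x.2⟩
  map_add' _ _ := Subtype.ext (smul_add _ _ _)
  map_smul' _ _ := Subtype.ext (smul_comm _ _ _)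

variable [IsLocalRing R]

/-- The `R`-module `𝐈ⁿ M / 𝔪 𝐈ⁿ M`, where `𝔪` is the maximal ideal of `R`. -/
abbrev FiberPiece (n : Fin r → ℕ) : Type v :=
  ↥(powSub I M n) ⧸ (IsLocalRing.maximalIdeal R • (⊤ : Submodule R ↥(powSub I M n)))

/-- Multiplication by `a ∈ 𝐈ⁱ` as the induced map `𝐈ʲ M / 𝔪 𝐈ʲ M → 𝐈ⁱ⁺ʲ M / 𝔪 𝐈ⁱ⁺ʲ M`. -/
def fiberMul {i j : Fin r → ℕ} (a : ↥(idealPow I i)) :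
    FiberPiece I M j →ₗ[R] FiberPiece I M (i + j) :=
  Submodule.mapQ _ _ (powSubMul I M a) (by
    rw [← Submodule.map_le_iff_le_comap, Submodule.map_smul'']
    exact Submodule.smul_mono le_rfl le_top)

variable {M} in
theorem fiberPiece_ext {i j : Fin r → ℕ} (h : i = j) (x : ↥(powSub I M i)) (y : ↥(powSub I M j))
    (hxy : (x : M) = y) :
    (GradedMonoid.mk i (Submodule.Quotient.mk x) : GradedMonoid (FiberPiece I M)) =
      GradedMonoid.mk j (Submodule.Quotient.mk y) := by
  subst h
  rw [Subtype.ext hxy]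

instance fiberPiece_gmodule :
    DirectSum.Gmodule (fun n : Fin r → ℕ => ↥(idealPow I n)) (FiberPiece I M) where
  smul a x := fiberMul I M a x
  one_smul := by
    rintro ⟨j, x⟩
    obtain ⟨x, rfl⟩ := Submodule.Quotient.mk_surjective _ x
    exact fiberPiece_ext I (zero_add j) _ _ (one_smul R (x : M))
  mul_smul := by
    rintro ⟨i, a⟩ ⟨i', a'⟩ ⟨j, x⟩
    obtain ⟨x, rfl⟩ := Submodule.Quotient.mk_surjective _ x
    exact fiberPiece_ext I (add_assoc i i' j) _ _ (mul_smul (a : R) (a' : R) (x : M))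
  smul_add a x y := map_add _ x y
  smul_zero a := map_zero _
  add_smul a a' x := by
    obtain ⟨x, rfl⟩ := Submodule.Quotient.mk_surjective _ x
    exact congrArg Submodule.Quotient.mk (Subtype.ext (add_smul (a : R) (a' : R) (x : M)))
  zero_smul x := by
    obtain ⟨x, rfl⟩ := Submodule.Quotient.mk_surjective _ x
    exact congrArg Submodule.Quotient.mk (Subtype.ext (zero_smul R (x : M)))

/-- `ℓ_M(𝐈)`: the Krull dimension (of the support) of the module `⨁ₙ 𝐈ⁿ M / 𝔪 𝐈ⁿ M` over the
multigraded Rees ring `ℛ(𝐈)`. The zero module has dimension `⊥`, that is, `-∞`. -/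
def multiSpread : WithBot ℕ∞ :=
  Module.supportDim (MultiRees I) (⨁ n : Fin r → ℕ, FiberPiece I M n)

end Fiber

/-- The `R`-module `Lₙ = (U + 𝐈ⁿ V) / 𝐈ⁿ W` for submodules `U`, `V`, `W` of `T`
(a genuine quotient by `𝐈ⁿ W` when `W ≤ V`). -/
abbrev LModule (I : Fin r → Ideal R) {T : Type v} [AddCommGroup T] [Module R T]
    (U V W : Submodule R T) (n : Fin r → ℕ) : Type v :=
  ↥(U ⊔ idealPow I n • V) ⧸ (idealPow I n • W).submoduleOf (U ⊔ idealPow I n • V)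

/-- The total degree of a multivariate polynomial, with the zero polynomial of degree `⊥`,
that is, `-∞`. -/
def totalDeg (P : MvPolynomial (Fin r) ℚ) : WithBot ℕ∞ :=
  P.support.sup fun s => ((s.degree : ℕ) : WithBot ℕ∞)

end

/-! The length of `Lₙ` splits along `U + 𝐈ⁿV ⊇ 𝐈ⁿV ⊇ 𝐈ⁿW` into that of `U / (U ∩ 𝐈ⁿV)` and that of
`𝐈ⁿV / 𝐈ⁿW`. Each summand is eventually polynomial; the first has degree at most `dim U`, the second
at most `ℓ - r`.

Polynomiality rests on a multigraded Hilbert theorem (`evPoly_subLen`) for quotients `Aₙ / Bₙ` of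
two families inside `𝐈ⁿV` that are closed under multiplication by the `Iᵢ`. One inducts on the
number of generators of the `Iᵢ` that may act nontrivially: kernel and cokernel of one generator
express a first difference through shorter cases. If some `Iᵢ` acts by zero, Artin–Rees
(`IsStable.exists_le_genPart`) makes the quotient vanish for large `n`. This applies directly to
`𝐈ⁿV / 𝐈ⁿW`, and to the first differences of the length of `U / (U ∩ 𝐈ⁿV)`; a function with
eventually polynomial differences is eventually polynomial (`EvPoly.of_differences`).

Degree of the first summand: finite length gives `𝔪ᵏU ⊆ 𝐈^(M,…,M) U'` for a suitable `U' ⊆ U`, by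
Artin–Rees. Iterating, `𝔪^(k(N+1)) U ⊆ U ∩ 𝐈ⁿV` with `N = n₁ + ⋯ + n_r`, and the Hilbert–Samuel
function of `U` grows at most like `N ^ dim U` (`exists_subLen_pow_smul_le`).

Degree of the second: finite length at one multidegree gives `𝔪ᵏ𝐈ⁿV ⊆ 𝐈ⁿW` for all larger `n`, so up
to a constant the length is bounded by that of the fiber piece `𝐈ⁿ(R/J) / 𝔪𝐈ⁿ(R/J)`. These pieces
are the components of a cyclic module over a finitely generated algebra over the residue field, of
dimension `ℓ`. Noether normalization bounds the sum of their lengths over total degree at most `N`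
by a multiple of `(N + 1) ^ ℓ`. Summing a nonzero polynomial over `r`-dimensional boxes raises its
degree by at least `r`, whence the `- r`. -/

noncomputable section

set_option linter.unusedSectionVars false

/-! ### Additivity and functoriality of the length of subquotients -/

section RelativeLength

variable {R : Type*} [CommRing R] {T : Type*} [AddCommGroup T] [Module R T]

/-- The length of the subquotient `A / (A ∩ B)`, for submodules `A` and `B` of a module. -/
def subLen (A B : Submodule R T) : ℕ∞ :=
  Module.length R (↥A ⧸ B.submoduleOf A)

theorem subLen_eq_of_surjective {X : Type*} [AddCommGroup X] [Module R X] {A B : Submodule R T}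
    (f : A →ₗ[R] X) (hf : Function.Surjective f) (hk : LinearMap.ker f = B.submoduleOf A) :
    subLen A B = Module.length R X := by
  rw [subLen, ← hk]
  exact (f.quotKerEquivOfSurjective hf).length_eq

theorem mem_submoduleOf_iff {A B : Submodule R T} {x : A} : x ∈ B.submoduleOf A ↔ (x : T) ∈ B :=
  Iff.rfl

theorem subLen_add {A B C : Submodule R T} (hCB : C ≤ B) (hBA : B ≤ A) :
    subLen A C = subLen A B + subLen B C := by
  have h₁ : C.submoduleOf B ≤ (C.submoduleOf A).comap (Submodule.inclusion hBA) := by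
    intro x hx
    rwa [Submodule.mem_comap, mem_submoduleOf_iff, Submodule.coe_inclusion, ← mem_submoduleOf_iff]
  have h₂ : C.submoduleOf A ≤ B.submoduleOf A := fun x hx =>
    mem_submoduleOf_iff.2 (hCB (mem_submoduleOf_iff.1 hx))
  rw [add_comm]
  refine Module.length_eq_add_of_exact
    (Submodule.mapQ (C.submoduleOf B) (C.submoduleOf A) (Submodule.inclusion hBA) h₁)
    (Submodule.factor h₂) ?_ (Submodule.factor_surjective _) ?_
  · rw [injective_iff_map_eq_zero]
    intro x hx
    obtain ⟨x, rfl⟩ := Submodule.Quotient.mk_surjective _ x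
    rw [Submodule.mapQ_apply, Submodule.Quotient.mk_eq_zero, mem_submoduleOf_iff] at hx
    rwa [Submodule.Quotient.mk_eq_zero, mem_submoduleOf_iff]
  · intro x
    obtain ⟨x, rfl⟩ := Submodule.Quotient.mk_surjective _ x
    rw [← Submodule.mkQ_apply, Submodule.factor_mk, Submodule.mkQ_apply, Submodule.mkQ_apply,
      Submodule.Quotient.mk_eq_zero, mem_submoduleOf_iff]
    constructor
    · intro hx
      exact ⟨Submodule.Quotient.mk ⟨x, hx⟩, rfl⟩
    · rintro ⟨y, hy⟩
      obtain ⟨y, rfl⟩ := Submodule.Quotient.mk_surjective _ y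
      rw [Submodule.mapQ_apply, Submodule.Quotient.eq, mem_submoduleOf_iff] at hy
      have := sub_mem y.2 (hCB hy)
      simpa using this

theorem subLen_le_of_le {A B C D : Submodule R T} (hCB : C ≤ B) (hBA : B ≤ A) (hDC : D ≤ C) :
    subLen B C ≤ subLen A D := by
  rw [subLen_add (hDC.trans hCB) hBA, subLen_add hDC hCB]
  exact le_add_self.trans' le_self_add

theorem subLen_sup (A C : Submodule R T) : subLen (A ⊔ C) C = subLen A (A ⊓ C) := by
  exact (LinearMap.quotientInfEquivSupQuotient A C).length_eq.symm

/-- The image of `A` modulo `B` under a linear map is the quotient of `A` by the preimage of `B`. -/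
theorem subLen_map_sup {T' : Type*} [AddCommGroup T'] [Module R T'] (f : T →ₗ[R] T')
    (A : Submodule R T) (B : Submodule R T') :
    subLen (A.map f ⊔ B) B = subLen A (A ⊓ B.comap f) := by
  rw [subLen_sup]
  symm
  refine subLen_eq_of_surjective
    (((A.map f ⊓ B).submoduleOf (A.map f)).mkQ ∘ₗ f.submoduleMap A)
    ((Submodule.mkQ_surjective _).comp (f.submoduleMap_surjective A)) ?_
  ext x
  rw [LinearMap.mem_ker, LinearMap.comp_apply, Submodule.mkQ_apply,
    Submodule.Quotient.mk_eq_zero]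
  simp [Submodule.submoduleOf]

theorem subLen_map_le {T' : Type*} [AddCommGroup T'] [Module R T'] (f : T →ₗ[R] T')
    {A B : Submodule R T} (hBA : B ≤ A) :
    subLen (A.map f) (B.map f) ≤ subLen A B := by
  have := subLen_map_sup f A (B.map f)
  rw [sup_eq_left.2 (Submodule.map_mono hBA)] at this
  rw [this]
  exact subLen_le_of_le inf_le_left le_rfl (le_inf hBA (Submodule.le_comap_map f B))

theorem subLen_self (A : Submodule R T) : subLen A A = 0 := by
  rw [subLen, Module.length_eq_zero_iff, Submodule.Quotient.subsingleton_iff]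
  exact Submodule.submoduleOf_self A

theorem subLen_top (B : Submodule R T) : subLen ⊤ B = Module.length R (T ⧸ B) := by
  refine subLen_eq_of_surjective (B.mkQ ∘ₗ (⊤ : Submodule R T).subtype) ?_ ?_
  · exact (Submodule.mkQ_surjective _).comp fun x => ⟨⟨x, trivial⟩, rfl⟩
  · ext x; simp [Submodule.submoduleOf]

end RelativeLength

/-! ### Difference calculus and growth of polynomials in several variables -/

section EventuallyPolynomial

open Filter MvPolynomial

variable {σ : Type*} [Fintype σ] [DecidableEq σ]

/-- The value at a tuple of natural numbers of a polynomial with rational coefficients. -/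
def natEval (n : σ → ℕ) (P : MvPolynomial σ ℚ) : ℚ :=
  eval (fun i => (n i : ℚ)) P

/-- The translate `P(x + eᵢ)` of a polynomial `P(x)`. -/
def shift (i : σ) : MvPolynomial σ ℚ →ₐ[ℚ] MvPolynomial σ ℚ :=
  aeval fun j => X j + C (Pi.single (M := fun _ => ℚ) i 1 j)

theorem eval_shift (i : σ) (x : σ → ℚ) (P : MvPolynomial σ ℚ) :
    eval x (shift i P) = eval (x + Pi.single i 1) P := by
  have : (aeval x).comp (shift i) = aeval (x + Pi.single i 1) := by
    ext j; simp [shift]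
  simpa [coe_aeval_eq_eval] using DFunLike.congr_fun this P

/-- The polynomial obtained by substituting a constant for one variable. -/
def substConst (i : σ) (c : ℚ) : MvPolynomial σ ℚ →ₐ[ℚ] MvPolynomial σ ℚ :=
  aeval (Function.update X i (C c))

theorem eval_substConst (i : σ) (c : ℚ) (x : σ → ℚ) (P : MvPolynomial σ ℚ) :
    eval x (substConst i c P) = eval (Function.update x i c) P := by
  have : (aeval x).comp (substConst i c) = aeval (Function.update x i c) := by
    ext j
    by_cases h : j = i
    · subst h; simp [substConst]
    · simp [substConst, h]
  simpa [coe_aeval_eq_eval] using DFunLike.congr_fun this P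

theorem shift_substConst (i : σ) (c : ℚ) (P : MvPolynomial σ ℚ) :
    shift i (substConst i c P) = substConst i c P := by
  refine MvPolynomial.funext fun x => ?_
  rw [eval_shift, eval_substConst, eval_substConst]
  refine congrArg (fun y => eval y P) (funext fun j => ?_)
  by_cases h : j = i
  · subst h; simp
  · simp [h]

theorem monomial_eq_X_pow_mul_erase (i : σ) (s : σ →₀ ℕ) (c : ℚ) :
    monomial s c = X i ^ s i * monomial (s.erase i) c := by
  rw [X_pow_eq_monomial, monomial_mul, one_mul, Finsupp.single_add_erase]

theorem shift_monomial_erase (i : σ) (s : σ →₀ ℕ) (c : ℚ) :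
    shift i (monomial (s.erase i) c) = monomial (s.erase i) c := by
  have : substConst i 1 (monomial (s.erase i) c) = monomial (s.erase i) c := by
    rw [substConst, aeval_monomial, monomial_eq, algebraMap_eq]
    congr 1
    refine Finsupp.prod_congr fun j hj => ?_
    have : j ≠ i := by
      rintro rfl; simp at hj
    simp [this]
  rw [← this, shift_substConst]

theorem shift_X (i : σ) : shift i (X i) = X i + 1 := by
  simp [shift]

/-- The Bernoulli polynomial satisfies `B_{k+1}(x + 1) - B_{k+1}(x) = (k + 1) xᵏ`. Splitting `xᵢᵏ`
off a monomial leaves a factor fixed by the translation, so dividing by `k + 1` gives an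
antidifference. -/
theorem exists_shift_sub_eq (i : σ) (P : MvPolynomial σ ℚ) : ∃ Q, shift i Q - Q = P := by
  induction P using MvPolynomial.monomial_add_induction_on with
  | C a =>
    refine ⟨C a * X i, ?_⟩
    have : shift i (C a) = C a := by simp [shift]
    rw [map_mul, this, shift_X]; ring
  | monomial_add s c P _ _ ih =>
    obtain ⟨Q, hQ⟩ := ih
    set k := s i
    set m := monomial (s.erase i) c
    let B := Polynomial.bernoulli (k + 1)
    have hB : shift i (Polynomial.aeval (X i) B) - Polynomial.aeval (X i) B =
        C ((k + 1 : ℕ) : ℚ) * X i ^ k := by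
      have h := congrArg (Polynomial.aeval (X i : MvPolynomial σ ℚ))
        (Polynomial.bernoulli_comp_one_add_X (k + 1))
      rw [Polynomial.aeval_comp] at h
      rw [← Polynomial.aeval_algHom_apply, shift_X, sub_eq_iff_eq_add']
      simp only [map_add, map_one, Polynomial.aeval_X, map_pow, map_nsmul] at h
      rw [add_comm, h]
      simp [B, nsmul_eq_mul]
    refine ⟨C (((k + 1 : ℕ) : ℚ)⁻¹) * Polynomial.aeval (X i) B * m + Q, ?_⟩
    have hC : shift i (C (((k + 1 : ℕ) : ℚ)⁻¹)) = C (((k + 1 : ℕ) : ℚ)⁻¹) := by simp [shift]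
    have hk : C (((k + 1 : ℕ) : ℚ)⁻¹) * C ((k + 1 : ℕ) : ℚ) = (1 : MvPolynomial σ ℚ) := by
      rw [← C_mul, inv_mul_cancel₀ (by positivity), C_1]
    rw [monomial_eq_X_pow_mul_erase i, map_add, map_mul, map_mul, hC,
      show shift i m = m from shift_monomial_erase i s c]
    linear_combination (C (((k + 1 : ℕ) : ℚ)⁻¹) * m) * hB + (X i ^ k * m) * hk + hQ

/-- Write `(x + 1)ᵏ - xᵏ` as a geometric sum, each of whose terms has degree at most `k - 1`. The
vanishing alternative covers `k = 0`, where the natural-number degree cannot drop. -/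
theorem totalDegree_shift_sub_monomial (i : σ) (s : σ →₀ ℕ) (c : ℚ) :
    shift i (monomial s c) - monomial s c = 0 ∨
      (shift i (monomial s c) - monomial s c).totalDegree + 1 ≤ s.degree := by
  rw [monomial_eq_X_pow_mul_erase i, map_mul, map_pow, shift_monomial_erase, shift_X, ← sub_mul,
    ← geom_sum₂_mul, add_sub_cancel_left, mul_one]
  rcases Nat.eq_zero_or_pos (s i) with h | h
  · left; simp [h]
  · right
    have h1 : (∑ j ∈ Finset.range (s i),
        (X i + 1 : MvPolynomial σ ℚ) ^ j * X i ^ (s i - 1 - j)).totalDegree ≤ s i - 1 := by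
      refine totalDegree_finsetSum_le fun j hj => ?_
      rw [Finset.mem_range] at hj
      refine (totalDegree_mul _ _).trans ?_
      have h2 : ((X i + 1 : MvPolynomial σ ℚ) ^ j).totalDegree ≤ j := by
        refine (totalDegree_pow _ _).trans ?_
        have : (X i + 1 : MvPolynomial σ ℚ).totalDegree ≤ 1 :=
          (totalDegree_add _ _).trans (by simp)
        nlinarith
      have h3 : ((X i : MvPolynomial σ ℚ) ^ (s i - 1 - j)).totalDegree ≤ s i - 1 - j := by simp
      omega
    have h4 : (monomial (s.erase i) c).totalDegree ≤ (s.erase i).degree :=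
      totalDegree_monomial_le _ _
    have h5 : s.degree = s i + (s.erase i).degree := by
      conv_lhs => rw [← Finsupp.single_add_erase i s]
      simp
    have := totalDegree_mul (∑ j ∈ Finset.range (s i),
        (X i + 1 : MvPolynomial σ ℚ) ^ j * X i ^ (s i - 1 - j)) (monomial (s.erase i) c)
    omega

/-- Taking a difference lowers the total degree. -/
theorem totalDegree_add_one_le_of_shift_sub_eq {i : σ} {P Q : MvPolynomial σ ℚ}
    (h : shift i Q - Q = P) (hP : P ≠ 0) : P.totalDegree + 1 ≤ Q.totalDegree := by
  have hsum : P = ∑ s ∈ Q.support, (shift i (monomial s (coeff s Q)) - monomial s (coeff s Q)) := by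
    rw [Finset.sum_sub_distrib, ← map_sum, ← Q.as_sum, h]
  have hlt : P.totalDegree < Q.totalDegree := by
    rw [hsum]
    by_cases hQ : Q.totalDegree = 0
    · exfalso
      apply hP
      rw [totalDegree_eq_zero_iff_eq_C] at hQ
      rw [← h, hQ]
      simp [shift]
    · refine (totalDegree_finsetSum _ _).trans_lt ?_
      rw [Finset.sup_lt_iff (Nat.pos_of_ne_zero hQ)]
      intro s hs
      have hs' : s.degree ≤ Q.totalDegree := le_totalDegree hs
      rcases totalDegree_shift_sub_monomial i s (coeff s Q) with h0 | h0
      · rw [h0, totalDegree_zero]; omega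
      · omega
  exact hlt

theorem natCast_update (n : σ → ℕ) (i : σ) (t : ℕ) :
    (fun j => ((Function.update n i t j : ℕ) : ℚ)) = Function.update (fun j => (n j : ℚ)) i t := by
  ext j
  by_cases h : j = i
  · subst h; simp
  · simp [h]

theorem natEval_shift (n : σ → ℕ) (i : σ) (P : MvPolynomial σ ℚ) :
    natEval n (shift i P) = natEval (n + Pi.single i 1) P := by
  rw [natEval, natEval, eval_shift]
  refine congrArg (fun y => eval y P) (funext fun j => ?_)
  by_cases h : j = i
  · subst h; simp
  · simp [h]

theorem update_add_single (n : σ → ℕ) (i : σ) (t : ℕ) :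
    Function.update n i (t + 1) = Function.update n i t + Pi.single i 1 := by
  ext j
  by_cases h : j = i
  · subst h; simp
  · simp [h]

/-- Telescoping along one coordinate. -/
theorem sum_Ico_update_sub (f : (σ → ℕ) → ℚ) (n : σ → ℕ) (i : σ) (c : ℕ) (hc : c ≤ n i) :
    ∑ t ∈ Finset.Ico c (n i), (f (Function.update n i t + Pi.single i 1) - f (Function.update n i t))
      = f n - f (Function.update n i c) := by
  simp_rw [← update_add_single]
  rw [Finset.sum_Ico_sub (f := fun t => f (Function.update n i t)) hc, Function.update_eq_self]

/-- Normalizing an antidifference by subtracting its restriction to `xᵢ = c` leaves the difference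
unchanged, and the sum then telescopes. -/
theorem exists_sum_Ico_eq (P : MvPolynomial σ ℚ) (i : σ) (c : ℕ) :
    ∃ Q : MvPolynomial σ ℚ, shift i Q - Q = P ∧ ∀ n : σ → ℕ, c ≤ n i →
      natEval n Q = ∑ t ∈ Finset.Ico c (n i), natEval (Function.update n i t) P := by
  obtain ⟨Q, hQ⟩ := exists_shift_sub_eq i P
  refine ⟨Q - substConst i c Q, ?_, fun n hn => ?_⟩
  · rw [map_sub, shift_substConst, ← hQ]; ring
  · have := sum_Ico_update_sub (fun n => natEval n Q) n i c hn
    rw [← hQ]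
    simp only [← natEval_shift] at this
    simp only [natEval, map_sub] at this ⊢
    rw [this, eval_substConst, natCast_update]

/-- A function on `ℕ^σ` which agrees with a polynomial at all large arguments. -/
def EvPoly (f : (σ → ℕ) → ℚ) : Prop :=
  ∃ P : MvPolynomial σ ℚ, ∀ᶠ n in atTop, f n = natEval n P

theorem EvPoly.sub {f g : (σ → ℕ) → ℚ} (hf : EvPoly f) (hg : EvPoly g) :
    EvPoly fun n => f n - g n := by
  obtain ⟨P, hP⟩ := hf
  obtain ⟨Q, hQ⟩ := hg
  refine ⟨P - Q, ?_⟩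
  filter_upwards [hP, hQ] with n h1 h2
  rw [h1, h2, natEval, natEval, natEval, map_sub]

theorem EvPoly.congr {f g : (σ → ℕ) → ℚ} (hf : EvPoly f) (h : ∀ᶠ n in atTop, g n = f n) :
    EvPoly g := by
  obtain ⟨P, hP⟩ := hf
  refine ⟨P, ?_⟩
  filter_upwards [hP, h] with n h1 h2
  rw [h2, h1]

/-- If all first differences of a function are eventually polynomial, then so is the function. -/
theorem EvPoly.of_differences {f : (σ → ℕ) → ℚ}
    (h : ∀ i, EvPoly fun n => f (n + Pi.single i 1) - f n) : EvPoly f := by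
  choose P hP using h
  obtain ⟨c, hc⟩ := eventually_atTop.1 (eventually_all.2 hP)
  -- Free the coordinates one at a time: those outside `s` stay frozen at `c`, and each new one is
  -- reached by telescoping from its frozen value.
  have key : ∀ s : Finset σ, ∃ Q : MvPolynomial σ ℚ, ∀ n, c ≤ n → (∀ j, j ∉ s → n j = c j) →
      f n = natEval n Q := by
    intro s
    induction s using Finset.induction_on with
    | empty =>
      refine ⟨C (f c), fun n _ hn => ?_⟩
      have : n = c := funext fun j => hn j (by simp)
      rw [this, natEval, eval_C]
    | insert i s _ ih =>
      obtain ⟨Q, hQ⟩ := ih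
      obtain ⟨S, -, hS⟩ := exists_sum_Ico_eq (P i) i (c i)
      refine ⟨substConst i (c i) Q + S, fun n hn hns => ?_⟩
      have h1 := sum_Ico_update_sub f n i (c i) (hn i)
      have h2 : f (Function.update n i (c i)) = natEval n (substConst i (c i) Q) := by
        rw [hQ, natEval, natEval, eval_substConst, natCast_update]
        · exact le_update_iff.2 ⟨le_rfl, fun j _ => hn j⟩
        · intro j hj
          by_cases hji : j = i
          · subst hji; simp
          · rw [Function.update_of_ne hji]
            exact hns j (by simp [hji, hj])
      have h3 : natEval n S = f n - f (Function.update n i (c i)) := by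
        rw [← h1, hS n (hn i)]
        refine Finset.sum_congr rfl fun t ht => ?_
        refine (hc _ ?_ i).symm
        exact le_update_iff.2 ⟨(Finset.mem_Ico.1 ht).1, fun j _ => hn j⟩
      rw [natEval, map_add]
      change _ = natEval n _ + natEval n _
      rw [h3, ← h2]; ring
  obtain ⟨Q, hQ⟩ := key Finset.univ
  exact ⟨Q, eventually_atTop.2 ⟨c, fun n hn => hQ n hn fun j hj => (hj (Finset.mem_univ j)).elim⟩⟩

/-- The box with sides `[cⱼ, nⱼ)` for `j ∈ s` and `{nⱼ}` for `j ∉ s`. -/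
def partialBox (s : Finset σ) (c n : σ → ℕ) : Finset (σ → ℕ) :=
  Fintype.piFinset fun j => if j ∈ s then Finset.Ico (c j) (n j) else {n j}

theorem mem_partialBox {s : Finset σ} {c n m : σ → ℕ} : m ∈ partialBox s c n ↔
    ∀ j, (j ∈ s → c j ≤ m j ∧ m j < n j) ∧ (j ∉ s → m j = n j) := by
  simp only [partialBox, Fintype.mem_piFinset]
  refine forall_congr' fun j => ?_
  split_ifs with h <;> simp [h]

/-- Summing a nonzero polynomial over boxes gives a polynomial whose degree is larger by the
dimension of the box. -/
theorem exists_sum_partialBox_eq (P : MvPolynomial σ ℚ) (c : σ → ℕ) (s : Finset σ) :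
    ∃ Q : MvPolynomial σ ℚ, (P ≠ 0 → Q ≠ 0 ∧ P.totalDegree + s.card ≤ Q.totalDegree) ∧
      ∀ n, c ≤ n → natEval n Q = ∑ m ∈ partialBox s c n, natEval m P := by
  induction s using Finset.induction_on with
  | empty =>
    refine ⟨P, fun h => ⟨h, by simp⟩, fun n _ => ?_⟩
    have : partialBox ∅ c n = {n} := by
      ext m; simp [mem_partialBox, funext_iff]
    rw [this, Finset.sum_singleton]
  | insert i s hi ih =>
    obtain ⟨Q, hQ0, hQ⟩ := ih
    obtain ⟨S, hS0, hS⟩ := exists_sum_Ico_eq Q i (c i)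
    refine ⟨S, fun hP => ⟨?_, ?_⟩, fun n hn => ?_⟩
    · rintro rfl
      exact (hQ0 hP).1 (by rw [← hS0]; simp)
    · have := totalDegree_add_one_le_of_shift_sub_eq hS0 (hQ0 hP).1
      have := (hQ0 hP).2
      rw [Finset.card_insert_of_notMem hi]
      omega
    -- The slice of the larger box at `mᵢ = t` is the smaller box with `nᵢ` replaced by `t`.
    · rw [hS n (hn i), ← Finset.sum_fiberwise_of_maps_to (g := fun m : σ → ℕ => m i)
        (t := Finset.Ico (c i) (n i))]
      · refine Finset.sum_congr rfl fun t ht => ?_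
        rw [hQ _ (le_update_iff.2 ⟨(Finset.mem_Ico.1 ht).1, fun j _ => hn j⟩)]
        refine Finset.sum_congr ?_ fun _ _ => rfl
        ext m
        rw [Finset.mem_filter, mem_partialBox, mem_partialBox]
        constructor
        · intro h
          refine ⟨fun j => ?_, ?_⟩
          · by_cases hji : j = i
            · subst hji
              have := (h j).2 hi
              simp only [Function.update_self] at this
              simp [this, Finset.mem_Ico.1 ht]
            · have := h j
              simpa [hji] using this
          · simpa using (h i).2 hi
        · rintro ⟨h, hm⟩ j
          by_cases hji : j = i
          · subst hji
            simp [hm, hi]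
          · have := h j
            simpa [hji] using this
      · intro m hm
        rw [mem_partialBox] at hm
        exact Finset.mem_Ico.2 ((hm i).1 (Finset.mem_insert_self i s))

/-- Positive coordinates are required so that the multiples `t • a` eventually dominate every
multi-index. -/
theorem exists_natEval_ne_zero {P : MvPolynomial σ ℚ} (hP : P ≠ 0) :
    ∃ a : σ → ℕ, (∀ i, 1 ≤ a i) ∧ natEval a P ≠ 0 := by
  by_contra! h
  refine hP (MvPolynomial.funext_set (fun _ => Set.range fun k : ℕ => ((k + 1 : ℕ) : ℚ))
    (fun _ => Set.infinite_range_of_injective fun a b hab => by simpa using hab) fun x hx => ?_)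
  choose a ha using fun i => hx i trivial
  have := h (fun i => a i + 1) fun i => by omega
  rw [natEval] at this
  rw [map_zero, ← this]
  exact congrArg (fun y => eval y P) (funext fun i => (ha i).symm)

/-- A polynomial of growth at most that of `|n|^d` has total degree at most `d`. -/
theorem totalDegree_le_of_growth {P : MvPolynomial σ ℚ} {K : ℚ} {d : ℕ}
    (h : ∀ᶠ n : σ → ℕ in atTop, |natEval n P| ≤ K * (1 + ∑ i, (n i : ℚ)) ^ d) :
    P.totalDegree ≤ d := by
  rcases eq_or_ne P 0 with rfl | hP
  · simp
  set δ := P.totalDegree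
  have htop : homogeneousComponent δ P ≠ 0 := by
    obtain ⟨s, hs, hsd⟩ := P.support.exists_mem_eq_sup (support_nonempty.2 hP)
      fun s => s.sum fun _ e => e
    intro h0
    have h1 := congrArg (coeff s) h0
    rw [coeff_homogeneousComponent, if_pos, coeff_zero] at h1
    · exact mem_support_iff.1 hs h1
    · exact hsd.symm
  -- Restrict `P` to the ray `t • a`, where the top homogeneous component becomes a nonzero
  -- coefficient of `t ^ δ`; this reduces the claim to one variable.
  obtain ⟨a, ha1, ha⟩ := exists_natEval_ne_zero htop
  let p : Polynomial ℚ := ∑ k ∈ Finset.range (δ + 1),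
    Polynomial.C (natEval a (homogeneousComponent k P)) * Polynomial.X ^ k
  have hpc : p.coeff δ = natEval a (homogeneousComponent δ P) := by
    simp [p, Polynomial.finsetSum_coeff, Polynomial.coeff_X_pow]
  have hpe : ∀ t : ℕ, p.eval (t : ℚ) = natEval (t • a) P := by
    intro t
    conv_rhs => rw [natEval, ← sum_homogeneousComponent P, map_sum]
    rw [Polynomial.eval_finsetSum]
    refine Finset.sum_congr rfl fun k _ => ?_
    rw [Polynomial.eval_mul, Polynomial.eval_C, Polynomial.eval_pow, Polynomial.eval_X, natEval,
      eval_eq', eval_eq', Finset.sum_mul]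
    refine Finset.sum_congr rfl fun s hs => ?_
    have hsk : ∑ i, s i = k := by
      have := homogeneousComponent_isHomogeneous k P (mem_support_iff.1 hs)
      rwa [show (1 : σ → ℕ) = fun _ => 1 from rfl, ← Finsupp.degree_eq_weight_one,
        Finsupp.degree_eq_sum] at this
    simp only [Pi.smul_apply, smul_eq_mul, Nat.cast_mul, mul_pow, Finset.prod_mul_distrib,
      Finset.prod_pow_eq_pow_sum, hsk]
    ring
  by_contra! hlt
  let A : ℚ := ∑ i, (a i : ℚ)
  -- With `|K| + 1` in place of `K`, this bound is positive on `ℕ` whatever the sign of `K`, so one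
  -- may divide by it.
  let q : Polynomial ℚ := Polynomial.C (|K| + 1) * (1 + Polynomial.C A * Polynomial.X) ^ d
  have hA : 0 ≤ A := by positivity
  have hq : ∀ t : ℕ, 0 < q.eval (t : ℚ) := by
    intro t
    simp only [q, Polynomial.eval_mul, Polynomial.eval_C, Polynomial.eval_pow, Polynomial.eval_add,
      Polynomial.eval_one, Polynomial.eval_X]
    positivity
  have hq0 : q ≠ 0 := by
    intro h0; simpa [h0] using hq 0
  have hdeg : q.degree < p.degree := by
    refine lt_of_le_of_lt ?_ (lt_of_lt_of_le (Nat.cast_lt.2 hlt)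
      (Polynomial.le_degree_of_ne_zero (by rwa [hpc])))
    refine (Polynomial.degree_C_mul (by positivity)).trans_le ?_
    refine (Polynomial.degree_pow_le _ _).trans ?_
    have : (1 + Polynomial.C A * Polynomial.X : Polynomial ℚ).degree ≤ 1 := by
      refine (Polynomial.degree_add_le _ _).trans (max_le ?_ (Polynomial.degree_C_mul_X_le _))
      exact Polynomial.degree_one_le.trans (by norm_num)
    calc d • (1 + Polynomial.C A * Polynomial.X : Polynomial ℚ).degree ≤ d • (1 : WithBot ℕ) :=
          nsmul_le_nsmul_right this d
      _ = d := by simp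
  have hlim := (Polynomial.abs_div_tendsto_atTop_atTop_of_degree_gt p q hdeg hq0).comp
    (tendsto_natCast_atTop_atTop (R := ℚ))
  have hta : Tendsto (fun t : ℕ => t • a) atTop atTop := by
    refine tendsto_atTop.2 fun c => ?_
    filter_upwards [eventually_ge_atTop (∑ i, c i)] with t ht i
    calc c i ≤ ∑ i, c i := Finset.single_le_sum (fun _ _ => Nat.zero_le _) (Finset.mem_univ i)
      _ ≤ t * 1 := by simpa using ht
      _ ≤ t * a i := Nat.mul_le_mul_left _ (ha1 i)
  obtain ⟨t, ht1, ht2⟩ := ((hta.eventually h).and (hlim.eventually_gt_atTop 1)).exists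
  rw [Function.comp_apply, abs_div, abs_of_pos (hq t), lt_div_iff₀ (hq t), one_mul, hpe] at ht2
  have h3 : K * (1 + ∑ i, (((t • a) i : ℕ) : ℚ)) ^ d ≤ q.eval (t : ℚ) := by
    simp only [q, Polynomial.eval_mul, Polynomial.eval_C, Polynomial.eval_pow, Polynomial.eval_add,
      Polynomial.eval_one, Polynomial.eval_X]
    have : ∑ i, (((t • a) i : ℕ) : ℚ) = A * t := by
      simp [A, Finset.mul_sum, mul_comm]
    rw [this]
    refine mul_le_mul_of_nonneg_right ?_ (by positivity)
    linarith [le_abs_self K]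
  linarith

/-- If a nonnegative eventually polynomial function has sums of growth at most `|n|^D` over boxes,
then its degree plus the number of variables is at most `D`. -/
theorem totalDegree_add_card_le_of_growth_sum {P : MvPolynomial σ ℚ} (hP : P ≠ 0) {K : ℚ} {D : ℕ}
    {c : σ → ℕ}
    (h : ∀ n, c ≤ n → |∑ m ∈ partialBox Finset.univ c n, natEval m P| ≤
      K * (1 + ∑ i, (n i : ℚ)) ^ D) :
    P.totalDegree + Fintype.card σ ≤ D := by
  obtain ⟨Q, hQ0, hQ⟩ := exists_sum_partialBox_eq P c Finset.univ
  refine (hQ0 hP).2.trans (totalDegree_le_of_growth (K := K) ?_)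
  exact eventually_atTop.2 ⟨c, fun n hn => by rw [hQ n hn]; exact h n hn⟩

end EventuallyPolynomial

/-! ### The multigraded Artin–Rees lemma -/

section ArtinRees

open MvPolynomial

variable {R : Type*} [CommRing R] {r : ℕ} {ι : Type*}

/-- The multidegree of the variable with index `j`, where `d j` tells to which ideal it belongs. -/
def varDeg (d : ι → Fin r) (j : ι) : Fin r → ℕ :=
  Pi.single (d j) 1

theorem multiIndex_induction {p : (Fin r → ℕ) → Prop} (h0 : p 0)
    (hs : ∀ n i, p n → p (n + Pi.single i 1)) (n : Fin r → ℕ) : p n := by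
  induction hk : ∑ i, n i generalizing n with
  | zero =>
    have : n = 0 := by
      ext i
      exact (Finset.sum_eq_zero_iff.1 hk) i (Finset.mem_univ i)
    rwa [this]
  | succ k ih =>
    obtain ⟨i, -, hi⟩ := Finset.exists_ne_zero_of_sum_ne_zero (hk.trans_ne k.succ_ne_zero)
    have hle : Pi.single i 1 ≤ n := by
      intro j
      by_cases h : j = i
      · subst h; simpa [Nat.one_le_iff_ne_zero] using hi
      · simp [h]
    obtain ⟨m, rfl⟩ := exists_add_of_le hle
    rw [add_comm]
    refine hs m i (ih m ?_)
    simp only [Pi.add_apply, Finset.sum_add_distrib, Finset.sum_pi_single', Finset.mem_univ,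
      if_true] at hk
    omega

theorem idealPow_single (I : Fin r → Ideal R) (i : Fin r) :
    idealPow I (Pi.single i 1) = I i := by
  rw [idealPow, Finset.prod_eq_single i] <;> simp +contextual

/-- Every element of `𝐈ⁿ` is the value of a multihomogeneous polynomial at generators of the
ideals `Iᵢ`. -/
theorem exists_isWeightedHomogeneous_aeval_eq {I : Fin r → Ideal R} {a : ι → R} {d : ι → Fin r}
    (hI : ∀ i, I i = Ideal.span (a '' {j | d j = i})) (n : Fin r → ℕ) :
    ∀ x ∈ idealPow I n, ∃ p : MvPolynomial ι R,
      p.IsWeightedHomogeneous (varDeg d) n ∧ aeval a p = x := by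
  induction n using multiIndex_induction with
  | h0 =>
    intro x _
    exact ⟨C x, isWeightedHomogeneous_C _ _, by simp⟩
  | hs n i ih =>
    intro x hx
    rw [idealPow_add, idealPow_single] at hx
    refine Submodule.mul_induction_on hx ?_ ?_
    · intro y hy z hz
      rw [hI] at hz
      induction hz using Submodule.span_induction with
      | mem z hz =>
        obtain ⟨j, rfl, rfl⟩ := hz
        obtain ⟨p, hp, rfl⟩ := ih y hy
        exact ⟨p * X j, hp.mul (isWeightedHomogeneous_X _ _ _), by simp⟩
      | zero => exact ⟨0, isWeightedHomogeneous_zero _ _ _, by simp⟩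
      | add z w _ _ h1 h2 =>
        obtain ⟨p, hp, hp'⟩ := h1
        obtain ⟨q, hq, hq'⟩ := h2
        exact ⟨p + q, (weightedHomogeneousSubmodule R (varDeg d) _).add_mem hp hq, by
          rw [map_add, hp', hq', mul_add]⟩
      | smul c z _ h =>
        obtain ⟨p, hp, hp'⟩ := h
        exact ⟨c • p, (weightedHomogeneousSubmodule R (varDeg d) _).smul_mem c hp, by
          rw [map_smul, hp', smul_eq_mul, smul_eq_mul]; ring⟩
    · rintro x y ⟨p, hp, rfl⟩ ⟨q, hq, rfl⟩
      exact ⟨p + q, (weightedHomogeneousSubmodule R (varDeg d) _).add_mem hp hq, map_add _ _ _⟩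

/-- The value at `a` of the component of multidegree `n` of a polynomial. -/
def evalComp (a : ι → R) (d : ι → Fin r) (n : Fin r → ℕ) : MvPolynomial ι R →ₗ[R] R :=
  (aeval a).toLinearMap ∘ₗ weightedHomogeneousComponent (varDeg d) n

theorem evalComp_monomial (a : ι → R) (d : ι → Fin r) (n : Fin r → ℕ) (s : ι →₀ ℕ) (c : R) :
    evalComp a d n (monomial s c) =
      if Finsupp.weight (varDeg d) s = n then aeval a (monomial s c) else 0 := by
  rw [evalComp, LinearMap.comp_apply, weightedHomogeneousComponent_of_mem
    (isWeightedHomogeneous_monomial (varDeg d) s c rfl)]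
  split_ifs with h1 h2 h2
  · rfl
  · exact (h2 h1.symm).elim
  · exact (h1 h2.symm).elim
  · simp

theorem evalComp_X_mul (a : ι → R) (d : ι → Fin r) (n : Fin r → ℕ) (j : ι)
    (p : MvPolynomial ι R) :
    evalComp a d (n + varDeg d j) (X j * p) = a j * evalComp a d n p := by
  induction p using MvPolynomial.induction_on' with
  | monomial s c =>
    have : X j * monomial s c = monomial (Finsupp.single j 1 + s) c := by
      rw [X, monomial_mul, one_mul]
    rw [this, evalComp_monomial, evalComp_monomial, ← this, map_mul, aeval_X, map_add,
      Finsupp.weight_single, one_smul]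
    simp [add_comm n]
  | add p q hp hq => rw [mul_add, map_add, map_add, hp, hq, mul_add]

theorem evalComp_X_mul_of_not_le (a : ι → R) (d : ι → Fin r) {n : Fin r → ℕ} {j : ι}
    (h : ¬ varDeg d j ≤ n) (p : MvPolynomial ι R) :
    evalComp a d n (X j * p) = 0 := by
  induction p using MvPolynomial.induction_on' with
  | monomial s c =>
    have : X j * monomial s c = monomial (Finsupp.single j 1 + s) c := by
      rw [X, monomial_mul, one_mul]
    rw [this, evalComp_monomial, map_add, Finsupp.weight_single, one_smul,
      if_neg]
    rintro rfl
    exact h le_self_add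
  | add p q hp hq => rw [mul_add, map_add, hp, hq, add_zero]

theorem exists_evalComp_eq_zero_of_not_le (a : ι → R) (d : ι → Fin r) (p : MvPolynomial ι R) :
    ∃ c : Fin r → ℕ, ∀ n, ¬ n ≤ c → evalComp a d n p = 0 := by
  refine ⟨p.support.sup (Finsupp.weight (varDeg d)), fun n hn => ?_⟩
  rw [evalComp, LinearMap.comp_apply, weightedHomogeneousComponent_eq_zero', map_zero]
  rintro s hs rfl
  exact hn (Finset.le_sup hs)

variable {T : Type*} [AddCommGroup T] [Module R T]

/-- The map from a free module over the polynomial ring to a module spanned by a family `v`,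
extracting the component of multidegree `n` and evaluating it. -/
def evalCompVec (a : ι → R) (d : ι → Fin r) {p : ℕ} (v : Fin p → T) (n : Fin r → ℕ) :
    (Fin p → MvPolynomial ι R) →ₗ[R] T :=
  ∑ k, (LinearMap.toSpanSingleton R T (v k)) ∘ₗ evalComp a d n ∘ₗ LinearMap.proj k

theorem evalCompVec_apply (a : ι → R) (d : ι → Fin r) {p : ℕ} (v : Fin p → T) (n : Fin r → ℕ)
    (z : Fin p → MvPolynomial ι R) :
    evalCompVec a d v n z = ∑ k, evalComp a d n (z k) • v k := by
  simp [evalCompVec]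

theorem evalCompVec_X_smul (a : ι → R) (d : ι → Fin r) {p : ℕ} (v : Fin p → T) (n : Fin r → ℕ)
    (j : ι) (z : Fin p → MvPolynomial ι R) :
    evalCompVec a d v (n + varDeg d j) ((X j : MvPolynomial ι R) • z) =
      a j • evalCompVec a d v n z := by
  simp [evalCompVec_apply, evalComp_X_mul, Finset.smul_sum, mul_smul]

theorem evalCompVec_X_smul_of_not_le (a : ι → R) (d : ι → Fin r) {p : ℕ} (v : Fin p → T)
    {n : Fin r → ℕ} {j : ι} (h : ¬ varDeg d j ≤ n) (z : Fin p → MvPolynomial ι R) :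
    evalCompVec a d v n ((X j : MvPolynomial ι R) • z) = 0 := by
  simp [evalCompVec_apply, evalComp_X_mul_of_not_le _ _ h]

theorem evalCompVec_C_smul (a : ι → R) (d : ι → Fin r) {p : ℕ} (v : Fin p → T)
    (n : Fin r → ℕ) (c : R) (z : Fin p → MvPolynomial ι R) :
    evalCompVec a d v n ((C c : MvPolynomial ι R) • z) = c • evalCompVec a d v n z := by
  rw [← map_smul]
  congr 1
  ext k : 1
  simp [C_mul']

/-- The lift can be taken homogeneous, so that conditions imposed on all its components need
checking only in degree `n`. -/
theorem exists_evalCompVec_eq {I : Fin r → Ideal R} {a : ι → R} {d : ι → Fin r}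
    (hI : ∀ i, I i = Ideal.span (a '' {j | d j = i})) {p : ℕ} (v : Fin p → T) (n : Fin r → ℕ) :
    ∀ x ∈ idealPow I n • Submodule.span R (Set.range v), ∃ z : Fin p → MvPolynomial ι R,
      evalCompVec a d v n z = x ∧ ∀ m ≠ n, evalCompVec a d v m z = 0 := by
  intro x hx
  obtain ⟨b, hb, rfl⟩ := (Submodule.mem_ideal_smul_span_iff_exists_sum _ _ _).1 hx
  choose q hq hqb using fun k => exists_isWeightedHomogeneous_aeval_eq hI n (b k) (hb k)
  refine ⟨q, ?_, fun m hm => ?_⟩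
  · rw [evalCompVec_apply, Finsupp.sum_fintype _ _ (by simp)]
    refine Finset.sum_congr rfl fun k _ => ?_
    rw [evalComp, LinearMap.comp_apply, (hq k).weightedHomogeneousComponent_same,
      AlgHom.toLinearMap_apply, hqb]
  · rw [evalCompVec_apply]
    refine Finset.sum_eq_zero fun k _ => ?_
    rw [evalComp, LinearMap.comp_apply, (hq k).weightedHomogeneousComponent_ne m hm, map_zero,
      zero_smul]

/-- A family of submodules `Fₙ ⊆ 𝐈ⁿV` is stable if it is closed under multiplication by the given
generators of the ideals `Iᵢ`. -/
def IsStable (a : ι → R) (d : ι → Fin r) (F : (Fin r → ℕ) → Submodule R T) : Prop :=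
  ∀ j n, ∀ x ∈ F n, a j • x ∈ F (n + varDeg d j)

/-- The part of `F (n + eᵢ)` obtained from `F n` by multiplication with generators of `Iᵢ`. -/
def genPart (a : ι → R) (d : ι → Fin r) (F : (Fin r → ℕ) → Submodule R T) (n : Fin r → ℕ)
    (i : Fin r) : Submodule R T :=
  ⨆ j : {j // d j = i}, (F n).map (LinearMap.lsmul R T (a j))

theorem smul_mem_genPart {a : ι → R} {d : ι → Fin r} {F : (Fin r → ℕ) → Submodule R T}
    {n : Fin r → ℕ} (j : ι) {x : T} (hx : x ∈ F n) : a j • x ∈ genPart a d F n (d j) :=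
  Submodule.mem_iSup_of_mem ⟨j, rfl⟩ ⟨x, hx, rfl⟩

theorem smul_mem_genPart_add {a : ι → R} {d : ι → Fin r} {F : (Fin r → ℕ) → Submodule R T}
    (hF : IsStable a d F) {n : Fin r → ℕ} (i : Fin r) (j : ι) {x : T}
    (hx : x ∈ genPart a d F n i) : a j • x ∈ genPart a d F (n + varDeg d j) i := by
  suffices genPart a d F n i ≤ (genPart a d F (n + varDeg d j) i).comap
    (LinearMap.lsmul R T (a j)) from this hx
  refine iSup_le ?_
  rintro ⟨k, rfl⟩
  rw [Submodule.map_le_iff_le_comap]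
  intro y hy
  have := smul_mem_genPart (a := a) (d := d) (F := F) k (hF j n y hy)
  simpa [smul_comm (a j) (a k)] using this

/-- A multigraded version of the Artin–Rees lemma: a stable family of submodules of `𝐈ⁿV` is
generated in bounded degrees. -/
theorem IsStable.exists_le_genPart [IsNoetherianRing R] [Finite ι] {I : Fin r → Ideal R}
    {a : ι → R} {d : ι → Fin r} (hI : ∀ i, I i = Ideal.span (a '' {j | d j = i}))
    {V : Submodule R T} (hV : V.FG) {F : (Fin r → ℕ) → Submodule R T} (hF : IsStable a d F)
    (hFV : ∀ n, F n ≤ idealPow I n • V) :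
    ∃ c : Fin r → ℕ, ∀ n i, c i ≤ n i → F (n + Pi.single i 1) ≤ genPart a d F n i := by
  obtain ⟨p, v, rfl⟩ := Submodule.fg_iff_exists_fin_generating_family.1 hV
  -- `G` collects the vectors all of whose components evaluate into `F`. Stability of `F` makes it a
  -- submodule of a free module of finite rank over a Noetherian polynomial ring, hence finitely
  -- generated; `c` will bound the multidegrees of its generators.
  let G : Submodule (MvPolynomial ι R) (Fin p → MvPolynomial ι R) :=
    { carrier := {z | ∀ n, evalCompVec a d v n z ∈ F n}
      add_mem' := fun hx hy n => by
        rw [map_add]; exact add_mem (hx n) (hy n)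
      zero_mem' := fun n => by rw [map_zero]; exact zero_mem _
      smul_mem' := fun q z hz => by
        induction q using MvPolynomial.induction_on with
        | C c => intro n; rw [evalCompVec_C_smul]; exact Submodule.smul_mem _ _ (hz n)
        | add q q' h h' =>
          intro n; rw [add_smul, map_add]; exact add_mem (h n) (h' n)
        | mul_X q j h =>
          intro n
          rw [mul_comm, mul_smul]
          by_cases hj : varDeg d j ≤ n
          · obtain ⟨m, rfl⟩ := exists_add_of_le hj
            rw [add_comm, evalCompVec_X_smul]
            exact hF j m _ (h m)
          · rw [evalCompVec_X_smul_of_not_le _ _ _ hj]; exact zero_mem _ }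
  obtain ⟨g, hg⟩ : G.FG := IsNoetherian.noetherian G
  have hbd : ∃ c : Fin r → ℕ, ∀ z ∈ g, ∀ n, ¬ n ≤ c → evalCompVec a d v n z = 0 := by
    choose c hc using exists_evalComp_eq_zero_of_not_le a d
    refine ⟨g.sup fun z => Finset.univ.sup fun k => c (z k), fun z hz n hn => ?_⟩
    rw [evalCompVec_apply]
    refine Finset.sum_eq_zero fun k _ => ?_
    rw [hc (z k) n, zero_smul]
    exact fun h => hn (h.trans ((Finset.le_sup (f := fun k => c (z k)) (Finset.mem_univ k)).trans
      (Finset.le_sup (f := fun z => Finset.univ.sup fun k => c (z k)) hz)))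
  obtain ⟨c, hc⟩ := hbd
  have key : ∀ z ∈ G, ∀ n i, c i ≤ n i →
      evalCompVec a d v (n + Pi.single i 1) z ∈ genPart a d F n i := by
    intro z hz
    have hzg : z ∈ Submodule.span (MvPolynomial ι R) (g : Set _) := hg.symm ▸ hz
    clear hz
    induction hzg using Submodule.span_induction with
    | mem z hz =>
      intro n i hn
      rw [hc z hz]
      · exact zero_mem _
      · intro h
        have := h i
        simp at this
        omega
    | zero => intro n i _; rw [map_zero]; exact zero_mem _
    | add z w _ _ h h' => intro n i hn; rw [map_add]; exact add_mem (h n i hn) (h' n i hn)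
    | smul q z hz h =>
      rw [hg] at hz
      induction q using MvPolynomial.induction_on with
      | C c => intro n i hn; rw [evalCompVec_C_smul]; exact Submodule.smul_mem _ _ (h n i hn)
      | add q q' h h' =>
        intro n i hn; rw [add_smul, map_add]; exact add_mem (h n i hn) (h' n i hn)
      | mul_X q j h' =>
        intro n i hn
        rw [mul_comm, mul_smul]
        by_cases hj : varDeg d j ≤ n + Pi.single i 1
        · obtain ⟨m, hm⟩ := exists_add_of_le hj
          rw [hm, add_comm, evalCompVec_X_smul]
          -- If `X j` belongs to `Iᵢ`, it supplies the required last factor itself. Otherwise that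
          -- factor comes from the inductive hypothesis one step lower in direction `d j`, where the
          -- `i`-th coordinate is unchanged.
          by_cases hji : d j = i
          · subst hji
            have : m = n := by
              rw [add_comm n] at hm
              exact (add_left_cancel hm).symm
            subst this
            exact smul_mem_genPart j (G.smul_mem q hz m)
          · have hmi : m i = n i + 1 := by
              have := congrFun hm i
              simp [varDeg, Ne.symm hji] at this
              omega
            have hle : Pi.single i 1 ≤ m := by
              intro k
              by_cases hk : k = i
              · subst hk; simp [hmi]
              · simp [hk]
            obtain ⟨l, rfl⟩ := exists_add_of_le hle
            have hl : n = l + varDeg d j := by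
              have : n + Pi.single i 1 = l + varDeg d j + Pi.single i 1 := by
                rw [hm]; abel
              exact add_right_cancel this
            rw [add_comm (Pi.single i 1) l, hl]
            refine smul_mem_genPart_add hF i j (h' l i ?_)
            simp at hmi
            omega
        · rw [evalCompVec_X_smul_of_not_le _ _ _ hj]; exact zero_mem _
  refine ⟨c, fun n i hn x hx => ?_⟩
  obtain ⟨z, rfl, hz⟩ := exists_evalCompVec_eq hI v _ x (hFV _ hx)
  refine key z (fun m => ?_) n i hn
  by_cases hm : m = n + Pi.single i 1
  · rwa [hm]
  · rw [hz m hm]; exact zero_mem _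

end ArtinRees

/-! ### Hilbert polynomials of quotients of stable families -/

section HilbertFunction

open Filter MvPolynomial

variable {R : Type*} [CommRing R] {r : ℕ} {ι : Type*} {T : Type*} [AddCommGroup T] [Module R T]

theorem EvPoly.comp_add_single {f : (Fin r → ℕ) → ℚ} (hf : EvPoly f) (i : Fin r) :
    EvPoly fun n => f (n + Pi.single i 1) := by
  obtain ⟨P, hP⟩ := hf
  obtain ⟨c, hc⟩ := eventually_atTop.1 hP
  refine ⟨shift i P, eventually_atTop.2 ⟨c, fun n hn => ?_⟩⟩
  rw [natEval_shift]
  exact hc _ (hn.trans le_self_add)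

/-- The elements of a family `A` which a given generator `a j` multiplies into a family `B`. -/
def colonFamily (a : ι → R) (d : ι → Fin r) (A B : (Fin r → ℕ) → Submodule R T) (j : ι)
    (n : Fin r → ℕ) : Submodule R T :=
  A n ⊓ (B (n + varDeg d j)).comap (LinearMap.lsmul R T (a j))

/-- The family obtained from `B` by adding the multiples by `a j` of elements of `A`. -/
def addMulFamily (a : ι → R) (d : ι → Fin r) (A B : (Fin r → ℕ) → Submodule R T) (j : ι)
    (n : Fin r → ℕ) : Submodule R T :=
  (⨆ m : {m // m + varDeg d j = n}, (A m).map (LinearMap.lsmul R T (a j))) ⊔ B n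

theorem addMulFamily_add (a : ι → R) (d : ι → Fin r) (A B : (Fin r → ℕ) → Submodule R T) (j : ι)
    (n : Fin r → ℕ) : addMulFamily a d A B j (n + varDeg d j) =
      (A n).map (LinearMap.lsmul R T (a j)) ⊔ B (n + varDeg d j) := by
  rw [addMulFamily]
  congr 1
  refine le_antisymm (iSup_le ?_) (le_iSup_of_le ⟨n, rfl⟩ le_rfl)
  rintro ⟨m, hm⟩
  obtain rfl : m = n := add_right_cancel hm
  exact le_rfl

theorem le_addMulFamily (a : ι → R) (d : ι → Fin r) (A B : (Fin r → ℕ) → Submodule R T) (j : ι)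
    (n : Fin r → ℕ) : B n ≤ addMulFamily a d A B j n :=
  le_sup_right

theorem addMulFamily_le {a : ι → R} {d : ι → Fin r} {A B : (Fin r → ℕ) → Submodule R T}
    (hA : IsStable a d A) (hBA : ∀ n, B n ≤ A n) (j : ι) (n : Fin r → ℕ) :
    addMulFamily a d A B j n ≤ A n := by
  refine sup_le (iSup_le ?_) (hBA n)
  rintro ⟨m, rfl⟩
  rw [Submodule.map_le_iff_le_comap]
  exact fun x hx => hA j m x hx

theorem isStable_colonFamily {a : ι → R} {d : ι → Fin r} {A B : (Fin r → ℕ) → Submodule R T}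
    (hA : IsStable a d A) (hB : IsStable a d B) (j : ι) : IsStable a d (colonFamily a d A B j) := by
  rintro k n x ⟨hx, hx'⟩
  refine ⟨hA k n x hx, ?_⟩
  have := hB k _ _ hx'
  rw [add_right_comm, LinearMap.lsmul_apply, smul_comm] at this
  exact this

theorem isStable_addMulFamily {a : ι → R} {d : ι → Fin r} {A B : (Fin r → ℕ) → Submodule R T}
    (hA : IsStable a d A) (hB : IsStable a d B) (j : ι) :
    IsStable a d (addMulFamily a d A B j) := by
  intro k n x hx
  suffices addMulFamily a d A B j n ≤ (addMulFamily a d A B j (n + varDeg d k)).comap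
    (LinearMap.lsmul R T (a k)) from this hx
  refine sup_le (iSup_le ?_) fun y hy => Submodule.mem_sup_right (hB k n y hy)
  rintro ⟨m, rfl⟩
  rw [Submodule.map_le_iff_le_comap]
  intro y hy
  rw [Submodule.mem_comap, Submodule.mem_comap, LinearMap.lsmul_apply, LinearMap.lsmul_apply,
    smul_comm, add_right_comm, addMulFamily_add]
  exact Submodule.mem_sup_left ⟨_, hA k m y hy, rfl⟩

/-- Multiplication by `a j` maps `Aₙ / Bₙ` to the quotient in the next degree; `colonFamily` gives
its kernel and `addMulFamily` its cokernel. The alternating sum of lengths in this four-term exact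
sequence is the claim. -/
theorem subLen_sub_subLen {a : ι → R} {d : ι → Fin r} {A B : (Fin r → ℕ) → Submodule R T}
    (hA : IsStable a d A) (hB : IsStable a d B) (hBA : ∀ n, B n ≤ A n) (j : ι) (n : Fin r → ℕ)
    (h1 : subLen (A n) (B n) ≠ ⊤)
    (h2 : subLen (A (n + varDeg d j)) (B (n + varDeg d j)) ≠ ⊤) :
    ((subLen (A (n + varDeg d j)) (B (n + varDeg d j))).toNat : ℚ) - (subLen (A n) (B n)).toNat =
      (subLen (A (n + varDeg d j)) (addMulFamily a d A B j (n + varDeg d j))).toNat -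
        (subLen (colonFamily a d A B j n) (B n)).toNat := by
  have e1 : subLen (A (n + varDeg d j)) (B (n + varDeg d j)) =
      subLen (A (n + varDeg d j)) (addMulFamily a d A B j (n + varDeg d j)) +
        subLen (A n) (colonFamily a d A B j n) := by
    rw [subLen_add (le_addMulFamily a d A B j _) (addMulFamily_le hA hBA j _)]
    refine congrArg _ ?_
    rw [addMulFamily_add, subLen_map_sup]
    rfl
  have e2 : subLen (A n) (B n) = subLen (A n) (colonFamily a d A B j n) +
      subLen (colonFamily a d A B j n) (B n) :=
    subLen_add (le_inf (hBA n) fun x hx => hB j n x hx) inf_le_left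
  rw [e1] at h2 ⊢
  rw [e2] at h1 ⊢
  rw [Ne, ENat.add_eq_top, not_or] at h1 h2
  rw [ENat.toNat_add h1.1 h1.2, ENat.toNat_add h2.1 h2.2]
  push_cast
  ring

/-- Hilbert's theorem on multigraded modules: the lengths of the quotients of two stable families
of submodules of `𝐈ⁿV` are given by a polynomial as soon as they are eventually finite. -/
theorem evPoly_subLen [IsNoetherianRing R] [Finite ι] {I : Fin r → Ideal R}
    {a : ι → R} {d : ι → Fin r} (hI : ∀ i, I i = Ideal.span (a '' {j | d j = i}))
    {V : Submodule R T} (hV : V.FG) {A B : (Fin r → ℕ) → Submodule R T} (τ : Finset ι)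
    (hA : IsStable a d A) (hB : IsStable a d B) (hBA : ∀ n, B n ≤ A n)
    (hAV : ∀ n, A n ≤ idealPow I n • V)
    (hτ : ∀ j ∉ τ, ∀ n, ∀ x ∈ A n, a j • x ∈ B (n + varDeg d j))
    (hfin : ∀ᶠ n in atTop, subLen (A n) (B n) ≠ ⊤) :
    EvPoly fun n => ((subLen (A n) (B n)).toNat : ℚ) := by
  classical
  induction hk : τ.card using Nat.strong_induction_on generalizing τ A B with
  | _ k ih =>
  subst hk
  -- `τ` contains every generator that may act nontrivially on `A / B`. If it meets each `Iᵢ`, every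
  -- first difference is handled by passing to the kernel and cokernel of some `a j`, on which `a j`
  -- acts by zero and can be removed from `τ`.
  by_cases h : ∀ i, ∃ j ∈ τ, d j = i
  · refine EvPoly.of_differences fun i => ?_
    obtain ⟨j, hj, rfl⟩ := h i
    have hcard := Finset.card_erase_lt_of_mem hj
    have hK : EvPoly fun n => ((subLen (colonFamily a d A B j n) (B n)).toNat : ℚ) := by
      have hBK : ∀ n, B n ≤ colonFamily a d A B j n := fun n =>
        le_inf (hBA n) fun x hx => hB j n x hx
      refine ih _ hcard _ (isStable_colonFamily hA hB j) hB hBK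
        (fun n => inf_le_left.trans (hAV n)) ?_ ?_ rfl
      · intro l hl n x hx
        by_cases hlj : l = j
        · subst hlj; exact hx.2
        · exact hτ l (fun h => hl (Finset.mem_erase.2 ⟨hlj, h⟩)) n x hx.1
      · filter_upwards [hfin] with n hn
        exact ne_top_of_le_ne_top hn (subLen_le_of_le (hBK n) inf_le_left le_rfl)
    have hC : EvPoly fun n => ((subLen (A n) (addMulFamily a d A B j n)).toNat : ℚ) := by
      have hle := addMulFamily_le hA hBA j
      refine ih _ hcard _ hA (isStable_addMulFamily hA hB j) hle hAV ?_ ?_ rfl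
      · intro l hl n x hx
        by_cases hlj : l = j
        · subst hlj
          rw [addMulFamily_add]
          exact Submodule.mem_sup_left ⟨x, hx, rfl⟩
        · exact Submodule.mem_sup_right
            (hτ l (fun h => hl (Finset.mem_erase.2 ⟨hlj, h⟩)) n x hx)
      · filter_upwards [hfin] with n hn
        exact ne_top_of_le_ne_top hn (subLen_le_of_le (hle n) le_rfl le_sup_right)
    refine ((hC.comp_add_single (d j)).sub hK).congr ?_
    obtain ⟨c, hc⟩ := eventually_atTop.1 hfin
    exact eventually_atTop.2 ⟨c, fun n hn =>
      subLen_sub_subLen hA hB hBA j n (hc n hn) (hc _ (hn.trans le_self_add))⟩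
  -- Here all generators of some `Iᵢ` carry `A` into `B`. By Artin–Rees, `A` is generated from lower
  -- degree in direction `i` once `nᵢ` is large, so `A = B` there and the polynomial is zero.
  · push Not at h
    obtain ⟨i, hi⟩ := h
    obtain ⟨c, hc⟩ := hA.exists_le_genPart hI hV hAV
    refine ⟨0, eventually_atTop.2 ⟨c + Pi.single i 1, fun n hn => ?_⟩⟩
    obtain ⟨m, rfl⟩ := exists_add_of_le (le_add_self.trans hn)
    rw [add_comm (Pi.single i 1) m] at hn ⊢
    have hm : c i ≤ m i := by
      have := hn i
      simpa using this
    have hAB : A (m + Pi.single i 1) ≤ B (m + Pi.single i 1) := by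
      refine (hc m i hm).trans (iSup_le ?_)
      rintro ⟨j, rfl⟩
      rw [Submodule.map_le_iff_le_comap]
      exact fun x hx => hτ j (fun h => hi j h rfl) m x hx
    simp [le_antisymm hAB (hBA _), subLen_self, natEval]

theorem IsStable.of_le {I : Fin r → Ideal R} {a : ι → R} {d : ι → Fin r}
    (hI : ∀ i, I i = Ideal.span (a '' {j | d j = i})) {F : (Fin r → ℕ) → Submodule R T}
    (hF : ∀ n i, I i • F n ≤ F (n + Pi.single i 1)) : IsStable a d F := by
  intro j n x hx
  refine hF n (d j) (Submodule.smul_mem_smul ?_ hx)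
  rw [hI]
  exact Ideal.subset_span ⟨j, rfl, rfl⟩

/-- Finitely generated ideals have a common finite generating family. -/
theorem exists_generators [IsNoetherianRing R] (I : Fin r → Ideal R) :
    ∃ (ι : Type) (_ : Finite ι) (a : ι → R) (d : ι → Fin r),
      ∀ i, I i = Ideal.span (a '' {j | d j = i}) := by
  choose p v hv using fun i => Submodule.fg_iff_exists_fin_generating_family.1
    (IsNoetherian.noetherian (I i))
  refine ⟨Σ i, Fin (p i), inferInstance, fun j => v j.1 j.2, fun j => j.1, fun i => ?_⟩
  rw [← hv i, Ideal.span]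
  congr 1
  ext x
  constructor
  · rintro ⟨k, rfl⟩
    exact ⟨⟨i, k⟩, rfl, rfl⟩
  · rintro ⟨⟨_, k⟩, rfl, rfl⟩
    exact ⟨k, rfl⟩

/-- Families closed under the ideals `Iᵢ` have an eventually polynomial length function. -/
theorem evPoly_subLen_of_smul_le [IsNoetherianRing R] (I : Fin r → Ideal R)
    {V : Submodule R T} (hV : V.FG) {A B : (Fin r → ℕ) → Submodule R T}
    (hA : ∀ n i, I i • A n ≤ A (n + Pi.single i 1))
    (hB : ∀ n i, I i • B n ≤ B (n + Pi.single i 1)) (hBA : ∀ n, B n ≤ A n)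
    (hAV : ∀ n, A n ≤ idealPow I n • V)
    (hfin : ∀ᶠ n in atTop, subLen (A n) (B n) ≠ ⊤) :
    EvPoly fun n => ((subLen (A n) (B n)).toNat : ℚ) := by
  obtain ⟨ι, _, a, d, hI⟩ := exists_generators I
  have := Fintype.ofFinite ι
  exact evPoly_subLen hI hV Finset.univ (.of_le hI hA) (.of_le hI hB) hBA hAV
    (fun j hj => (hj (Finset.mem_univ j)).elim) hfin

/-- The multigraded Artin–Rees lemma for ideals: families of submodules of `𝐈ⁿV` closed under the
ideals `Iᵢ` are eventually given by multiplication. -/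
theorem exists_le_smul_of_smul_le [IsNoetherianRing R] (I : Fin r → Ideal R)
    {V : Submodule R T} (hV : V.FG) {F : (Fin r → ℕ) → Submodule R T}
    (hF : ∀ n i, I i • F n ≤ F (n + Pi.single i 1)) (hFV : ∀ n, F n ≤ idealPow I n • V) :
    ∃ c : Fin r → ℕ, ∀ n, F (c + n) = idealPow I n • F c := by
  obtain ⟨ι, _, a, d, hI⟩ := exists_generators I
  obtain ⟨c, hc⟩ := (IsStable.of_le hI hF).exists_le_genPart hI hV hFV
  refine ⟨c, fun n => ?_⟩
  induction n using multiIndex_induction with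
  | h0 => simp [idealPow_zero]
  | hs n i ih =>
    rw [idealPow_add, idealPow_single, mul_comm, mul_smul, ← ih, ← add_assoc]
    refine le_antisymm ((hc (c + n) i (by simp)).trans (iSup_le ?_)) (hF _ i)
    rintro ⟨j, rfl⟩
    rw [Submodule.map_le_iff_le_comap]
    intro x hx
    refine Submodule.smul_mem_smul ?_ hx
    rw [hI]
    exact Ideal.subset_span ⟨j, rfl, rfl⟩

end HilbertFunction

/-! ### Finite length over local rings and Hilbert–Samuel growth -/

section SamuelFunction

open IsLocalRing

variable {R : Type*} [CommRing R]

theorem length_ne_top_of_pow_smul_eq_bot [IsNoetherianRing R] [IsLocalRing R] {X : Type*}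
    [AddCommGroup X] [Module R X] [Module.Finite R X] {k : ℕ}
    (h : maximalIdeal R ^ k • (⊤ : Submodule R X) = ⊥) : Module.length R X ≠ ⊤ := by
  -- The exponent is raised so that it is nonzero: then `𝔪` is minimal over the power, and the
  -- quotient ring over which `X` lives is Artinian.
  have h' : maximalIdeal R ^ (k + 1) • (⊤ : Submodule R X) = ⊥ := by
    rw [pow_succ', mul_smul, h, Submodule.smul_bot]
  have hmin : maximalIdeal R ∈ (maximalIdeal R ^ (k + 1)).minimalPrimes :=
    ⟨⟨inferInstance, Ideal.pow_le_self (Nat.succ_ne_zero k)⟩,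
      fun p hp _ => hp.1.le_of_pow_le hp.2⟩
  have := IsLocalRing.quotient_artinian_of_mem_minimalPrimes_of_isLocalRing _ hmin
  have h1 : IsArtinian (R ⧸ maximalIdeal R ^ (k + 1))
      (X ⧸ maximalIdeal R ^ (k + 1) • (⊤ : Submodule R X)) := by
    have : Module.Finite (R ⧸ maximalIdeal R ^ (k + 1))
      (X ⧸ maximalIdeal R ^ (k + 1) • (⊤ : Submodule R X)) :=
        Module.Finite.of_restrictScalars_finite R _ _
    infer_instance
  have h2 : IsArtinian R (X ⧸ maximalIdeal R ^ (k + 1) • (⊤ : Submodule R X)) :=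
    isArtinian_of_surjective_algebraMap (R := R ⧸ maximalIdeal R ^ (k + 1))
      Ideal.Quotient.mk_surjective
  rw [h'] at h2
  have : IsArtinian R X := isArtinian_of_linearEquiv (Submodule.quotEquivOfEqBot ⊥ rfl)
  exact Module.length_ne_top

theorem subLen_ne_top_of_pow_smul_le [IsNoetherianRing R] [IsLocalRing R] {T : Type*}
    [AddCommGroup T] [Module R T] {A B : Submodule R T} (hA : A.FG) {k : ℕ}
    (h : maximalIdeal R ^ k • A ≤ B) : subLen A B ≠ ⊤ := by
  have : Module.Finite R A := Module.Finite.iff_fg.2 hA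
  refine length_ne_top_of_pow_smul_eq_bot (k := k) ?_
  rw [eq_bot_iff, Submodule.smul_le]
  intro a ha x _
  obtain ⟨x, rfl⟩ := Submodule.Quotient.mk_surjective _ x
  rw [Submodule.mem_bot, ← Submodule.Quotient.mk_smul, Submodule.Quotient.mk_eq_zero]
  exact h (Submodule.smul_mem_smul ha x.2)

/-- A subquotient of finite length over a local ring is annihilated by a power of the maximal
ideal. -/
theorem exists_pow_smul_le_of_subLen_ne_top [IsLocalRing R] {T : Type*}
    [AddCommGroup T] [Module R T] {A B : Submodule R T}
    (h : subLen A B ≠ ⊤) : ∃ k, maximalIdeal R ^ k • A ≤ B := by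
  rw [subLen, Module.length_ne_top_iff, isFiniteLength_iff_isNoetherian_isArtinian] at h
  obtain ⟨h1, h2⟩ := h
  let X := ↥A ⧸ B.submoduleOf A
  let f : ℕ →o (Submodule R X)ᵒᵈ :=
    ⟨fun k => OrderDual.toDual (maximalIdeal R ^ k • (⊤ : Submodule R X)), fun i j hij =>
      Submodule.smul_mono_left (Ideal.pow_le_pow_right hij)⟩
  obtain ⟨k, hk⟩ := IsArtinian.monotone_stabilizes f
  have hk' : maximalIdeal R ^ k • (⊤ : Submodule R X) =
      maximalIdeal R ^ (k + 1) • (⊤ : Submodule R X) := hk (k + 1) (Nat.le_succ k)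
  -- The chain of submodules `𝔪ⁱX` has stabilized at `k`, and Nakayama's lemma kills its stable
  -- value.
  have hbot : maximalIdeal R ^ k • (⊤ : Submodule R X) = ⊥ := by
    refine Submodule.eq_bot_of_le_smul_of_le_jacobson_bot (maximalIdeal R) _
      (IsNoetherian.noetherian _) ?_ (maximalIdeal_le_jacobson _)
    rw [← mul_smul, ← pow_succ', ← hk']
  refine ⟨k, Submodule.smul_le.2 fun a ha x hx => ?_⟩
  have : a • (Submodule.Quotient.mk ⟨x, hx⟩ : X) ∈ maximalIdeal R ^ k • (⊤ : Submodule R X) :=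
    Submodule.smul_mem_smul ha trivial
  rw [hbot, Submodule.mem_bot, ← Submodule.Quotient.mk_smul, Submodule.Quotient.mk_eq_zero] at this
  exact this

variable {M : Type*} [AddCommGroup M] [Module R M]

/-- Multiplication by `yⁱ` carries `M / (yM + Q)` onto the `i`-th layer `(yⁱM + Q) / (yⁱ⁺¹M + Q)`,
and there are `N` layers. -/
theorem subLen_mul_pow_sup_le (y : R) (Q : Submodule R M) (N : ℕ) :
    subLen ⊤ ((⊤ : Submodule R M).map (LinearMap.lsmul R M (y ^ N)) ⊔ Q) ≤
      N * subLen ⊤ ((⊤ : Submodule R M).map (LinearMap.lsmul R M y) ⊔ Q) := by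
  induction N with
  | zero =>
    have : (⊤ : Submodule R M).map (LinearMap.lsmul R M (y ^ 0)) = ⊤ := by
      rw [eq_top_iff]; intro x _; exact ⟨x, trivial, by simp⟩
    rw [this, top_sup_eq, subLen_self]
    simp
  | succ N ih =>
    set B := fun N => (⊤ : Submodule R M).map (LinearMap.lsmul R M (y ^ N)) ⊔ Q with hB
    have hmap : (⊤ : Submodule R M).map (LinearMap.lsmul R M (y ^ (N + 1))) ≤
        (⊤ : Submodule R M).map (LinearMap.lsmul R M (y ^ N)) := by
      rintro _ ⟨x, -, rfl⟩
      exact ⟨y • x, trivial, by simp [pow_succ, smul_smul, mul_comm]⟩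
    have hle : B (N + 1) ≤ B N := sup_le_sup_right hmap Q
    have heq : B N = (⊤ : Submodule R M).map (LinearMap.lsmul R M (y ^ N)) ⊔ B (N + 1) := by
      refine le_antisymm (sup_le le_sup_left (le_sup_right.trans le_sup_right)) ?_
      exact sup_le le_sup_left hle
    calc subLen ⊤ (B (N + 1)) = subLen ⊤ (B N) + subLen (B N) (B (N + 1)) :=
          subLen_add hle le_top
      _ ≤ N * subLen ⊤ ((⊤ : Submodule R M).map (LinearMap.lsmul R M y) ⊔ Q) +
          subLen ⊤ ((⊤ : Submodule R M).map (LinearMap.lsmul R M y) ⊔ Q) := by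
        refine add_le_add ih ?_
        rw [heq, subLen_map_sup]
        refine subLen_le_of_le inf_le_left le_rfl (le_inf le_top (sup_le ?_ ?_))
        · rintro _ ⟨x, -, rfl⟩
          exact Submodule.mem_sup_left ⟨x, trivial, by simp [pow_succ, smul_smul, mul_comm]⟩
        · intro x hx
          exact Submodule.mem_sup_right (Q.smul_mem _ hx)
      _ = _ := by push_cast; rw [add_mul, one_mul]

/-- The elements are treated one at a time, each costing a factor `N`; `Q` is arbitrary so that it
can absorb the remaining ones. -/
theorem subLen_iSup_mul_pow_sup_le (s : Finset R) (Q : Submodule R M) (N : ℕ) :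
    subLen ⊤ ((⨆ y ∈ s, (⊤ : Submodule R M).map (LinearMap.lsmul R M (y ^ N))) ⊔ Q) ≤
      (N ^ s.card : ℕ) *
        subLen ⊤ ((⨆ y ∈ s, (⊤ : Submodule R M).map (LinearMap.lsmul R M y)) ⊔ Q) := by
  classical
  induction s using Finset.induction_on generalizing Q with
  | empty => simp
  | insert y s hy ih =>
    rw [Finset.iSup_insert, Finset.iSup_insert, Finset.card_insert_of_notMem hy, sup_assoc]
    refine (subLen_mul_pow_sup_le y _ N).trans ?_
    rw [sup_left_comm]
    refine (mul_le_mul_right (ih _) _).trans ?_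
    rw [← mul_assoc, sup_assoc, sup_left_comm]
    gcongr
    push_cast
    rw [pow_succ']

/-- The Hilbert–Samuel function of a module with respect to the maximal ideal has growth at most
that of `N ^ dim M`. -/
theorem exists_subLen_pow_smul_le [IsNoetherianRing R] [IsLocalRing R] [Module.Finite R M] {d : ℕ}
    (hd : Module.supportDim R M ≤ d) :
    ∃ K : ℕ, ∀ N : ℕ, subLen ⊤ (maximalIdeal R ^ N • (⊤ : Submodule R M)) ≤
      (K * (N + 1) ^ d : ℕ) := by
  classical
  rcases subsingleton_or_nontrivial M with hM | hM
  · refine ⟨0, fun N => ?_⟩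
    rw [Subsingleton.elim (maximalIdeal R ^ N • (⊤ : Submodule R M)) ⊤, subLen_self]
    simp
  rw [Module.supportDim_eq_ringKrullDim_quotient_annihilator] at hd
  set 𝔞 := Module.annihilator R M
  have : Nontrivial (R ⧸ 𝔞) := Ideal.Quotient.nontrivial_iff.2 (by
    rw [Ne, Module.annihilator_eq_top_iff]
    exact not_subsingleton M)
  have : IsLocalRing (R ⧸ 𝔞) :=
    .of_surjective' (Ideal.Quotient.mk 𝔞) Ideal.Quotient.mk_surjective
  -- A system of parameters of `R / ann M`: as many elements as the dimension, with the maximal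
  -- ideal minimal over them. It is lifted to `s` in `R` below.
  obtain ⟨s', hs', hcard⟩ :=
    (maximalIdeal (R ⧸ 𝔞)).exists_finset_card_eq_height_of_isNoetherianRing
  have hcard' : s'.card ≤ d := by
    rw [← maximalIdeal_height_eq_ringKrullDim, ← hcard] at hd
    exact_mod_cast hd
  have := IsLocalRing.quotient_artinian_of_mem_minimalPrimes_of_isLocalRing _ hs'
  obtain ⟨k, hk⟩ := exists_maximalIdeal_pow_le_of_isArtinianRing_quotient
    (Ideal.span (s' : Set (R ⧸ 𝔞)))
  obtain ⟨g, hg⟩ := Ideal.Quotient.mk_surjective (I := 𝔞).hasRightInverse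
  let s := s'.image g
  have hsc : s.card ≤ d := Finset.card_image_le.trans hcard'
  have hspan : (Ideal.span (s : Set R)).map (Ideal.Quotient.mk 𝔞) = Ideal.span s' := by
    rw [Ideal.map_span, Finset.coe_image, Set.image_image]
    simp only [hg _, Set.image_id']
  have hloc : IsLocalHom (Ideal.Quotient.mk 𝔞) :=
    .of_surjective (Ideal.Quotient.mk 𝔞) Ideal.Quotient.mk_surjective
  have hmk : ∀ x ∈ maximalIdeal R, Ideal.Quotient.mk 𝔞 x ∈ maximalIdeal (R ⧸ 𝔞) := fun x hx => by
    rw [mem_maximalIdeal] at hx ⊢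
    exact map_mem_nonunits_iff _ _ |>.2 hx
  have hsm : ∀ y ∈ s, y ∈ maximalIdeal R := by
    intro y hy
    obtain ⟨z, hz, rfl⟩ := Finset.mem_image.1 hy
    have : z ∈ maximalIdeal (R ⧸ 𝔞) := hs'.1.2 (Ideal.subset_span hz)
    rw [mem_maximalIdeal] at this ⊢
    rw [← hg z] at this
    exact (map_mem_nonunits_iff (Ideal.Quotient.mk 𝔞) _).1 this
  have hpow : maximalIdeal R ^ k ≤ Ideal.span (s : Set R) ⊔ 𝔞 := by
    have h1 : (maximalIdeal R).map (Ideal.Quotient.mk 𝔞) ≤ maximalIdeal (R ⧸ 𝔞) :=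
      Ideal.map_le_iff_le_comap.2 hmk
    have h2 : (maximalIdeal R ^ k).map (Ideal.Quotient.mk 𝔞) ≤
        (Ideal.span (s : Set R)).map (Ideal.Quotient.mk 𝔞) := by
      rw [Ideal.map_pow, hspan]
      exact (Ideal.pow_right_mono h1 k).trans hk
    rw [Ideal.map_le_iff_le_comap, Ideal.comap_map_of_surjective _ Ideal.Quotient.mk_surjective,
      ← RingHom.ker_eq_comap_bot, Ideal.mk_ker] at h2
    exact h2
  have hfin : subLen (⊤ : Submodule R M)
      (⨆ y ∈ s, (⊤ : Submodule R M).map (LinearMap.lsmul R M y)) ≠ ⊤ := by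
    refine subLen_ne_top_of_pow_smul_le (Module.Finite.fg_top) (k := k) ?_
    refine (Submodule.smul_mono_left hpow).trans ?_
    rw [Submodule.sup_smul]
    refine sup_le ?_ ?_
    · rw [Submodule.smul_le]
      intro a ha x _
      induction ha using Submodule.span_induction with
      | mem y hy =>
        exact Submodule.mem_iSup_of_mem y (Submodule.mem_iSup_of_mem hy ⟨x, trivial, rfl⟩)
      | zero => rw [zero_smul]; exact zero_mem _
      | add a b _ _ h h' => rw [add_smul]; exact add_mem h h'
      | smul c a _ h => rw [smul_assoc]; exact Submodule.smul_mem _ _ h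
    · rw [Submodule.smul_le]
      intro a ha x _
      rw [Module.mem_annihilator.1 ha x]
      exact zero_mem _
  obtain ⟨K, hK⟩ := ENat.ne_top_iff_exists.1 hfin
  refine ⟨K, fun N => ?_⟩
  have h1 := subLen_iSup_mul_pow_sup_le s (⊥ : Submodule R M) N
  rw [sup_bot_eq, sup_bot_eq, ← hK] at h1
  -- The `N`-th powers of the parameters lie in `𝔪ᴺ`, so `M / 𝔪ᴺM` is a quotient of the module whose
  -- length has just been bounded.
  have hle : (⨆ y ∈ s, (⊤ : Submodule R M).map (LinearMap.lsmul R M (y ^ N))) ≤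
      maximalIdeal R ^ N • (⊤ : Submodule R M) := by
    refine iSup₂_le fun y hy => ?_
    rintro _ ⟨x, -, rfl⟩
    exact Submodule.smul_mem_smul (Ideal.pow_mem_pow (hsm y hy) N) trivial
  refine (subLen_le_of_le le_top le_rfl hle).trans (h1.trans ?_)
  rw [← Nat.cast_mul, Nat.cast_le, mul_comm]
  refine Nat.mul_le_mul_left _ ?_
  exact (Nat.pow_le_pow_left (Nat.le_succ N) _).trans (Nat.pow_le_pow_right (Nat.succ_pos N) hsc)

end SamuelFunction

/-! ### Growth of finitely generated algebras over a field -/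

section AlgebraGrowth

open MvPolynomial

/-- Lying over lifts the bottom prime of a chain and going up lifts the rest. -/
theorem ringKrullDim_le_of_isIntegral_of_injective {A B : Type*} [CommRing A] [CommRing B]
    [Algebra A B] [Algebra.IsIntegral A B] (h : Function.Injective (algebraMap A B)) :
    ringKrullDim A ≤ ringKrullDim B := by
  refine iSup_le fun l => ?_
  obtain ⟨Q, -, hQ, hQl⟩ := Ideal.exists_ideal_over_prime_of_isIntegral (S := B) l.head.asIdeal ⊥
    (by rw [← RingHom.ker_eq_comap_bot, (RingHom.injective_iff_ker_eq_bot _).1 h]; exact bot_le)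
  have : Q.LiesOver (RelSeries.head l).asIdeal := ⟨hQl.symm⟩
  obtain ⟨L, hL, -⟩ := Ideal.exists_ltSeries_of_hasGoingUp l Q
  rw [← hL]
  exact le_iSup (fun L : LTSeries (PrimeSpectrum B) => (L.length : WithBot ℕ∞)) L

variable {K : Type*} [Field K] {F : Type*} [CommRing F] [Algebra K F]

/-- The span of the products of the monomials of degree at most `b` in some elements of an algebra
with given elements `e l`. -/
def boundedSpan {s q : ℕ} (g : MvPolynomial (Fin s) K →ₐ[K] F) (e : Fin q → F) (b : ℕ) :
    Submodule K F :=
  Submodule.span K {y | ∃ u : Fin s →₀ ℕ, u.degree ≤ b ∧ ∃ l, y = g (monomial u 1) * e l}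

theorem mul_mem_boundedSpan {s q : ℕ} (g : MvPolynomial (Fin s) K →ₐ[K] F) (e : Fin q → F)
    {b : ℕ} {p : MvPolynomial (Fin s) K} (hp : p.totalDegree ≤ b) (l : Fin q) :
    g p * e l ∈ boundedSpan g e b := by
  rw [p.as_sum, map_sum, Finset.sum_mul]
  refine Submodule.sum_mem _ fun u hu => ?_
  have : monomial u (coeff u p) = coeff u p • monomial u 1 := by
    rw [smul_monomial, smul_eq_mul, mul_one]
  rw [this, map_smul, smul_mul_assoc]
  exact Submodule.smul_mem _ _ (Submodule.subset_span ⟨u, (le_totalDegree hu).trans hp, l, rfl⟩)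

/-- `boundedSpan` is spanned by a number of elements growing polynomially with the degree bound. -/
theorem exists_finset_boundedSpan_le {s q : ℕ} (g : MvPolynomial (Fin s) K →ₐ[K] F)
    (e : Fin q → F) (b : ℕ) :
    ∃ G : Finset F, G.card ≤ (b + 1) ^ s * q ∧ boundedSpan g e b ≤ Submodule.span K G := by
  classical
  refine ⟨(Finset.univ : Finset ((Fin s → Fin (b + 1)) × Fin q)).image fun z =>
    g (monomial (Finsupp.equivFunOnFinite.symm fun i => (z.1 i : ℕ)) 1) * e z.2, ?_, ?_⟩
  · refine Finset.card_image_le.trans ?_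
    simp
  · refine Submodule.span_mono ?_
    rintro _ ⟨u, hu, l, rfl⟩
    have hui : ∀ i, u i < b + 1 := fun i =>
      Nat.lt_succ_of_le ((Finsupp.le_degree i u).trans hu)
    refine Finset.mem_coe.2 (Finset.mem_image.2 ⟨(fun i => ⟨u i, hui i⟩, l), Finset.mem_univ _, ?_⟩)
    exact congrArg (fun w => g (monomial w 1) * e l) (Finsupp.ext fun i => rfl)

/-- In a finitely generated algebra of dimension at most `D` over a field, the monomials of degree
at most `N` in the generators span a space of dimension at most a constant times `(N + 1) ^ D`. -/
theorem exists_finset_monomials_subset_span [Nontrivial F] {ι : Type*} [Finite ι] (x : ι → F)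
    (hx : Function.Surjective (aeval x : MvPolynomial ι K →ₐ[K] F)) {D : ℕ}
    (hD : ringKrullDim F ≤ D) :
    ∃ c : ℕ, ∀ N : ℕ, ∃ G : Finset F, G.card ≤ c * (N + 1) ^ D ∧
      ∀ s : ι →₀ ℕ, s.degree ≤ N → aeval x (monomial s (1 : K)) ∈ Submodule.span K (G : Set F) := by
  classical
  have := Fintype.ofFinite ι
  have hft : Algebra.FiniteType K F := .of_surjective (aeval x) hx
  -- Noether normalization: `F` is finite over a polynomial ring in `s` variables, and integrality
  -- forces `s ≤ D`.
  obtain ⟨s, g, hinj, hfin⟩ := exists_finite_inj_algHom_of_fg K F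
  have hs : s ≤ D := by
    let _ : Algebra (MvPolynomial (Fin s) K) F := g.toRingHom.toAlgebra
    have : Module.Finite (MvPolynomial (Fin s) K) F := hfin
    have h := ringKrullDim_le_of_isIntegral_of_injective (A := MvPolynomial (Fin s) K) (B := F) hinj
    rw [MvPolynomial.ringKrullDim_of_isNoetherianRing, ringKrullDim_eq_zero_of_field, zero_add,
      Nat.card_eq_fintype_card, Fintype.card_fin] at h
    exact_mod_cast h.trans hD
  obtain ⟨q, e, he⟩ : ∃ (q : ℕ) (e : Fin q → F), ∀ y, ∃ p : Fin q → MvPolynomial (Fin s) K,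
      y = ∑ l, g (p l) * e l := by
    let _ : Algebra (MvPolynomial (Fin s) K) F := g.toRingHom.toAlgebra
    have : Module.Finite (MvPolynomial (Fin s) K) F := hfin
    obtain ⟨q, e, he⟩ := Module.Finite.exists_fin (R := MvPolynomial (Fin s) K) (M := F)
    refine ⟨q, e, fun y => ?_⟩
    have hy : y ∈ Submodule.span (MvPolynomial (Fin s) K) (Set.range e) := he ▸ Submodule.mem_top
    obtain ⟨p, rfl⟩ := (Submodule.mem_span_range_iff_exists_fun _).1 hy
    exact ⟨p, rfl⟩
  choose p hp using he
  -- `b` bounds the degrees of the coefficients expressing `1` and the products `x i * e m` in the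
  -- module generators. Multiplying by one generator `x i` therefore raises the degree bound by at
  -- most `b`, so growth is linear in the monomial's degree.
  obtain ⟨b, hb1, hbx⟩ : ∃ b, (∀ l, (p 1 l).totalDegree ≤ b) ∧
      ∀ i m l, (p (x i * e m) l).totalDegree ≤ b := by
    refine ⟨(Finset.univ.sup fun l => (p 1 l).totalDegree) + Finset.univ.sup fun z : ι × Fin q × Fin q =>
      (p (x z.1 * e z.2.1) z.2.2).totalDegree, fun l => le_add_right ?_, fun i m l => le_add_left ?_⟩
    · exact Finset.le_sup (f := fun l => (p 1 l).totalDegree) (Finset.mem_univ l)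
    · exact Finset.le_sup (f := fun z : ι × Fin q × Fin q =>
        (p (x z.1 * e z.2.1) z.2.2).totalDegree) (Finset.mem_univ (i, m, l))
  have hmul : ∀ i k, ∀ y ∈ boundedSpan g e k, x i * y ∈ boundedSpan g e (k + b) := by
    intro i k y hy
    induction hy using Submodule.span_induction with
    | mem y hy =>
      obtain ⟨u, hu, l, rfl⟩ := hy
      rw [mul_left_comm, hp (x i * e l), Finset.mul_sum]
      refine Submodule.sum_mem _ fun m _ => ?_
      rw [← mul_assoc, ← map_mul]
      refine mul_mem_boundedSpan g e ((totalDegree_mul _ _).trans (add_le_add ?_ (hbx i l m))) m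
      exact (totalDegree_monomial_le _ _).trans hu
    | zero => rw [mul_zero]; exact zero_mem _
    | add y z _ _ h h' => rw [mul_add]; exact add_mem h h'
    | smul c y _ h => rw [mul_smul_comm]; exact Submodule.smul_mem _ _ h
  have hmon : ∀ N, ∀ u : ι →₀ ℕ, u.degree = N →
      aeval x (monomial u (1 : K)) ∈ boundedSpan g e (b * (N + 1)) := by
    intro N
    induction N with
    | zero =>
      intro u hu
      rw [Finsupp.degree_eq_zero_iff] at hu
      have : aeval x (monomial u (1 : K)) = 1 := by rw [hu]; simp
      rw [this, hp 1]
      refine Submodule.sum_mem _ fun l _ => mul_mem_boundedSpan g e ?_ l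
      simpa using hb1 l
    | succ N ih =>
      intro u hu
      obtain ⟨i, hi⟩ : ∃ i, u i ≠ 0 := by
        by_contra! h
        have : u = 0 := Finsupp.ext h
        simp [this] at hu
      have hle : Finsupp.single i 1 ≤ u := by
        rw [Finsupp.single_le_iff]; exact Nat.one_le_iff_ne_zero.2 hi
      obtain ⟨w, rfl⟩ := exists_add_of_le hle
      have hw : w.degree = N := by
        rw [map_add, Finsupp.degree_single] at hu; omega
      have : (monomial (Finsupp.single i 1 + w) (1 : K)) = X i * monomial w 1 := by
        rw [X, monomial_mul, one_mul]
      rw [this, map_mul, aeval_X]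
      have := hmul i _ _ (ih w hw)
      rwa [mul_add_one b (N + 1)]
  have hmono : ∀ {k k'}, k ≤ k' → boundedSpan g e k ≤ boundedSpan g e k' := fun h =>
    Submodule.span_mono fun y ⟨u, hu, l, hl⟩ => ⟨u, hu.trans h, l, hl⟩
  refine ⟨(b + 1) ^ s * q, fun N => ?_⟩
  obtain ⟨G, hG, hGs⟩ := exists_finset_boundedSpan_le g e (b * (N + 1))
  refine ⟨G, hG.trans ?_, fun u hu => ?_⟩
  · calc (b * (N + 1) + 1) ^ s * q ≤ ((b + 1) * (N + 1)) ^ s * q :=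
          Nat.mul_le_mul_right _ (Nat.pow_le_pow_left (by nlinarith) _)
      _ = (b + 1) ^ s * q * (N + 1) ^ s := by rw [mul_pow]; ring
      _ ≤ _ := Nat.mul_le_mul_left _ (Nat.pow_le_pow_right (Nat.succ_pos N) hs)
  · exact hGs (hmono (Nat.mul_le_mul_left b (Nat.succ_le_succ hu)) (hmon _ u rfl))

end AlgebraGrowth

/-! ### The fiber of the Rees ring and the analytic spread -/

section Fiber

open MvPolynomial IsLocalRing

variable {R : Type u} [CommRing R] {r : ℕ}

section Rees

variable {ι : Type*}

/-- The element of the Rees ring given by a generator `a j` of the ideal `I (d j)`. -/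
def reesVar {I : Fin r → Ideal R} {a : ι → R} {d : ι → Fin r}
    (hI : ∀ i, I i = Ideal.span (a '' {j | d j = i})) (j : ι) : MultiRees I :=
  DirectSum.of (fun n => ↥(idealPow I n)) (varDeg d j) ⟨a j, by
    rw [varDeg, idealPow_single, hI]; exact Ideal.subset_span ⟨j, rfl, rfl⟩⟩

/-- The span of the monomials of degree `k` in the generators of the Rees ring. -/
def reesMonomials {I : Fin r → Ideal R} {a : ι → R} {d : ι → Fin r}
    (hI : ∀ i, I i = Ideal.span (a '' {j | d j = i})) (k : ℕ) : Submodule R (MultiRees I) :=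
  Submodule.span R {y | ∃ s : ι →₀ ℕ, s.degree = k ∧ y = aeval (reesVar hI) (monomial s (1 : R))}

theorem mul_reesVar_mem {I : Fin r → Ideal R} {a : ι → R} {d : ι → Fin r}
    (hI : ∀ i, I i = Ideal.span (a '' {j | d j = i})) {k : ℕ} {y : MultiRees I}
    (hy : y ∈ reesMonomials hI k) (j : ι) : y * reesVar hI j ∈ reesMonomials hI (k + 1) := by
  induction hy using Submodule.span_induction with
  | mem y hy =>
    obtain ⟨s, hs, rfl⟩ := hy
    refine Submodule.subset_span ⟨s + Finsupp.single j 1, by simp [hs], ?_⟩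
    have : monomial (s + Finsupp.single j 1) (1 : R) = monomial s 1 * X j := by
      rw [X, monomial_mul, one_mul]
    rw [this, map_mul, aeval_X]
  | zero => rw [zero_mul]; exact zero_mem _
  | add y z _ _ h h' => rw [add_mul]; exact add_mem h h'
  | smul c y _ h => rw [smul_mul_assoc]; exact Submodule.smul_mem _ _ h

/-- This ties multidegree to monomial degree: elements of multidegree `n` need only monomials of
degree `n₁ + ⋯ + n_r`, which is what lets a bound on monomials count whole graded pieces. -/
theorem lof_mem_reesMonomials {I : Fin r → Ideal R} {a : ι → R} {d : ι → Fin r}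
    (hI : ∀ i, I i = Ideal.span (a '' {j | d j = i})) (n : Fin r → ℕ) (y : idealPow I n) :
    DirectSum.lof R _ (fun n => ↥(idealPow I n)) n y ∈ reesMonomials hI (∑ i, n i) := by
  -- The elements of `𝐈ⁿ` with the desired property form an ideal of `R`, so the induction can use
  -- `𝐈ⁿ⁺ᵉ = 𝐈ⁿIᵢ` and test on generators.
  let D : ∀ n : Fin r → ℕ, Ideal R := fun n => ((reesMonomials hI (∑ i, n i)).comap
    (DirectSum.lof R _ (fun n => ↥(idealPow I n)) n)).map (idealPow I n).subtype
  suffices h : ∀ n, idealPow I n ≤ D n by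
    obtain ⟨z, hz, hzy⟩ := h n y.2
    rwa [← Subtype.ext hzy]
  clear y n
  intro n
  induction n using multiIndex_induction with
  | h0 =>
    intro x _
    let o : ↥(idealPow I 0) := ⟨1, by simp [idealPow_zero]⟩
    have ho : DirectSum.lof R _ (fun n => ↥(idealPow I n)) 0 o = 1 := rfl
    refine ⟨x • o, ?_, mul_one x⟩
    change DirectSum.lof R _ (fun n => ↥(idealPow I n)) 0 (x • o) ∈
      reesMonomials hI _
    rw [map_smul, ho]
    exact Submodule.smul_mem _ _ (Submodule.subset_span ⟨0, by simp, by simp⟩)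
  | hs n i ih =>
    rw [idealPow_add, idealPow_single, hI, Ideal.mul_le]
    intro y hy z hz
    suffices h : Ideal.span (a '' {j | d j = i}) ≤
      Submodule.comap (LinearMap.toSpanSingleton R R y) (D (n + Pi.single i 1)) by
      simpa [mul_comm] using h hz
    rw [Ideal.span_le]
    rintro _ ⟨j, rfl, rfl⟩
    obtain ⟨y, hy', rfl⟩ := ih hy
    have hj : a j ∈ idealPow I (Pi.single (d j) 1) := by
      rw [idealPow_single, hI]; exact Ideal.subset_span ⟨j, rfl, rfl⟩
    refine ⟨⟨y * a j, by rw [idealPow_add]; exact Ideal.mul_mem_mul y.2 hj⟩, ?_,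
      by simp [mul_comm]⟩
    have h := mul_reesVar_mem hI hy' j
    have hsum : ∑ k, (n + Pi.single (d j) 1 : Fin r → ℕ) k = (∑ k, n k) + 1 := by
      simp [Finset.sum_add_distrib]
    rw [reesVar, DirectSum.lof_eq_of, DirectSum.of_mul_of, ← hsum] at h
    exact h

end Rees

section Module

/-- A version of `exists_finset_monomials_subset_span` for algebras over a local ring which are
annihilated by the maximal ideal. -/
theorem exists_finset_monomials_subset_span_of_isLocalRing [IsLocalRing R] {F : Type*} [CommRing F]
    [Algebra R F] [Nontrivial F] (hF : ∀ c ∈ maximalIdeal R, algebraMap R F c = 0)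
    {ι : Type*} [Finite ι] (x : ι → F)
    (hx : ∀ z, z ∈ Submodule.span R (Set.range fun s : ι →₀ ℕ => aeval x (monomial s (1 : R))))
    {D : ℕ} (hD : ringKrullDim F ≤ D) :
    ∃ c : ℕ, ∀ N : ℕ, ∃ G : Finset F, G.card ≤ c * (N + 1) ^ D ∧
      ∀ s : ι →₀ ℕ, s.degree ≤ N → aeval x (monomial s (1 : R)) ∈ Submodule.span R (G : Set F) := by
  let φ : ResidueField R →+* F := Ideal.Quotient.lift (maximalIdeal R) (algebraMap R F) hF
  let _ : Algebra (ResidueField R) F := φ.toAlgebra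
  have : IsScalarTower R (ResidueField R) F := .of_algebraMap_eq fun c => rfl
  have hmon : ∀ s : ι →₀ ℕ, aeval x (monomial s (1 : R)) =
      aeval x (monomial s (1 : ResidueField R)) := by
    intro s
    simp [aeval_monomial]
  have hx' : Function.Surjective (aeval x : MvPolynomial ι (ResidueField R) →ₐ[_] F) := by
    intro z
    suffices h : z ∈ (aeval x : MvPolynomial ι (ResidueField R) →ₐ[_] F).toLinearMap.range.restrictScalars R
      from h
    refine Submodule.span_le.2 ?_ (hx z)
    rintro _ ⟨s, rfl⟩
    exact ⟨_, (hmon s).symm⟩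
  obtain ⟨c, hc⟩ := exists_finset_monomials_subset_span x hx' hD
  refine ⟨c, fun N => ?_⟩
  obtain ⟨G, hG, hGs⟩ := hc N
  refine ⟨G, hG, fun s hs => ?_⟩
  rw [← Submodule.restrictScalars_span R (ResidueField R) Ideal.Quotient.mk_surjective, hmon]
  exact hGs s hs

theorem length_le_card_of_span_eq_top [IsLocalRing R] {X : Type*} [AddCommGroup X] [Module R X]
    (hm : ∀ c ∈ maximalIdeal R, ∀ x : X, c • x = 0) (G : Finset X)
    (hG : Submodule.span R (G : Set X) = ⊤) : Module.length R X ≤ G.card := by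
  classical
  let f : (G → R ⧸ maximalIdeal R) →ₗ[R] X := LinearMap.lsum R _ R fun g =>
    Submodule.liftQ (maximalIdeal R) (LinearMap.toSpanSingleton R X g) fun c hc =>
      LinearMap.mem_ker.2 (hm c hc g)
  have hf : Function.Surjective f := by
    rw [← LinearMap.range_eq_top, eq_top_iff, ← hG, Submodule.span_le]
    intro g hg
    refine ⟨Pi.single ⟨g, hg⟩ (Submodule.Quotient.mk 1), ?_⟩
    simp only [f, LinearMap.lsum_piSingle]
    exact one_smul R g
  have hs : IsSimpleModule R (R ⧸ maximalIdeal R) :=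
    isSimpleModule_iff_isCoatom.2 (IsLocalRing.maximalIdeal.isMaximal R).out
  refine (Module.length_le_of_surjective f hf).trans ?_
  rw [Module.length_pi, Module.length_eq_one]
  simp

variable (I : Fin r → Ideal R) (M : Type v) [AddCommGroup M] [Module R M] [IsLocalRing R]

/-- Keeping the target degree `k` separate from `i + j` avoids transporting elements along
equalities of multi-indices. -/
theorem of_smul_of_fiberPiece {i j k : Fin r → ℕ} (a : ↥(idealPow I i)) (x : ↥(powSub I M j))
    (y : ↥(powSub I M k)) (hk : i + j = k) (hy : (y : M) = (a : R) • (x : M)) :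
    (DirectSum.of (fun n => ↥(idealPow I n)) i a : MultiRees I) •
      (DirectSum.of (FiberPiece I M) j (Submodule.Quotient.mk x) :
        ⨁ n : Fin r → ℕ, FiberPiece I M n) =
      DirectSum.of (FiberPiece I M) k (Submodule.Quotient.mk y) := by
  rw [DirectSum.Gmodule.of_smul_of]
  exact DirectSum.of_eq_of_gradedMonoid_eq (fiberPiece_ext I hk _ _ hy.symm)

instance isScalarTower_multiRees :
    IsScalarTower R (MultiRees I) (⨁ n : Fin r → ℕ, FiberPiece I M n) where
  smul_assoc c z e := by
    induction z using DirectSum.induction_on with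
    | zero => simp only [smul_zero, zero_smul]
    | add z w h h' => rw [smul_add, add_smul, h, h', add_smul, smul_add]
    | of i a =>
      induction e using DirectSum.induction_on with
      | zero => simp only [smul_zero]
      | add z w h h' => rw [smul_add, smul_add, h, h', smul_add]
      | of j x =>
        obtain ⟨x, rfl⟩ := Submodule.Quotient.mk_surjective _ x
        rw [← DirectSum.of_smul, of_smul_of_fiberPiece I M (c • a) x
          (c • ⟨(a : R) • (x : M), powSub_smul_mem I a.2 x.2⟩) rfl (by simp [mul_smul]),
          of_smul_of_fiberPiece I M a x
          ⟨(a : R) • (x : M), powSub_smul_mem I a.2 x.2⟩ rfl rfl, ← DirectSum.of_smul]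
        rfl

theorem maximalIdeal_smul_eq_zero {c : R} (hc : c ∈ maximalIdeal R)
    {n : Fin r → ℕ} (x : FiberPiece I M n) : c • x = 0 := by
  obtain ⟨x, rfl⟩ := Submodule.Quotient.mk_surjective _ x
  rw [← Submodule.Quotient.mk_smul, Submodule.Quotient.mk_eq_zero]
  exact Submodule.smul_mem_smul hc trivial

variable (J : Ideal R)

/-- The class of `1` in degree zero of `⨁ₙ 𝐈ⁿ(R/J) / 𝔪𝐈ⁿ(R/J)`. -/
def fiberOne : ⨁ n : Fin r → ℕ, FiberPiece I (R ⧸ J) n :=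
  DirectSum.of (FiberPiece I (R ⧸ J)) 0 (Submodule.Quotient.mk ⟨1, by
    rw [powSub, idealPow_zero, one_smul]; trivial⟩)

theorem exists_of_smul_fiberOne (n : Fin r → ℕ) (x : FiberPiece I (R ⧸ J) n) :
    ∃ a : ↥(idealPow I n), (DirectSum.of (fun n => ↥(idealPow I n)) n a : MultiRees I) •
      fiberOne I J = DirectSum.of (FiberPiece I (R ⧸ J)) n x := by
  obtain ⟨⟨x, hx⟩, rfl⟩ := Submodule.Quotient.mk_surjective _ x
  have : ∃ a ∈ idealPow I n, x = a • (1 : R ⧸ J) := by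
    refine Submodule.smul_induction_on hx ?_ ?_
    · intro b hb y _
      obtain ⟨y, rfl⟩ := Ideal.Quotient.mk_surjective y
      refine ⟨b * y, Ideal.mul_mem_right _ _ hb, ?_⟩
      rw [mul_smul]
      congr 1
      rw [Algebra.smul_def, mul_one]; rfl
    · rintro _ _ ⟨b, hb, rfl⟩ ⟨c, hc, rfl⟩
      exact ⟨b + c, add_mem hb hc, (add_smul _ _ _).symm⟩
  obtain ⟨a, ha, hax⟩ := this
  exact ⟨⟨a, ha⟩, of_smul_of_fiberPiece I (R ⧸ J) _ _ _ (add_zero n) hax⟩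

theorem span_fiberOne_eq_top : Submodule.span (MultiRees I) {fiberOne I J} = ⊤ := by
  rw [eq_top_iff]
  rintro x -
  induction x using DirectSum.induction_on with
  | zero => exact zero_mem _
  | add x y h h' => exact add_mem h h'
  | of n x =>
    obtain ⟨a, ha⟩ := exists_of_smul_fiberOne I J n x
    exact ha ▸ Submodule.smul_mem _ _ (Submodule.mem_span_singleton_self _)

theorem finite_multiRees : Module.Finite (MultiRees I) (⨁ n : Fin r → ℕ, FiberPiece I (R ⧸ J) n) :=
  ⟨⟨{fiberOne I J}, by simpa using span_fiberOne_eq_top I J⟩⟩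

/-- The quotient of the Rees ring by the annihilator of `⨁ₙ 𝐈ⁿ(R/J) / 𝔪𝐈ⁿ(R/J)`. -/
def FiberRing : Type u :=
  MultiRees I ⧸ Module.annihilator (MultiRees I) (⨁ n : Fin r → ℕ, FiberPiece I (R ⧸ J) n)

instance : CommRing (FiberRing I J) :=
  inferInstanceAs (CommRing (MultiRees I ⧸ Module.annihilator (MultiRees I)
    (⨁ n : Fin r → ℕ, FiberPiece I (R ⧸ J) n)))

instance : Algebra R (FiberRing I J) :=
  inferInstanceAs (Algebra R (MultiRees I ⧸ Module.annihilator (MultiRees I)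
    (⨁ n : Fin r → ℕ, FiberPiece I (R ⧸ J) n)))

/-- The quotient map from the Rees ring. -/
def fiberMk : MultiRees I →ₐ[R] FiberRing I J :=
  Ideal.Quotient.mkₐ R (Module.annihilator (MultiRees I) (⨁ n, FiberPiece I (R ⧸ J) n))

theorem fiberMk_surjective : Function.Surjective (fiberMk I J) :=
  Ideal.Quotient.mk_surjective

theorem fiberMk_eq_zero_iff {z : MultiRees I} : fiberMk I J z = 0 ↔
    ∀ x : ⨁ n : Fin r → ℕ, FiberPiece I (R ⧸ J) n, z • x = 0 :=
  Ideal.Quotient.eq_zero_iff_mem.trans Module.mem_annihilator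

/-- The module is cyclic, hence finitely generated, so its support is the zero locus of its
annihilator. -/
theorem multiSpread_eq_ringKrullDim_fiberRing :
    multiSpread I (R ⧸ J) = ringKrullDim (FiberRing I J) := by
  have := finite_multiRees I J
  rw [multiSpread, Module.supportDim_eq_ringKrullDim_quotient_annihilator]
  rfl

theorem algebraMap_fiberRing_eq_zero {c : R} (hc : c ∈ maximalIdeal R) :
    algebraMap R (FiberRing I J) c = 0 := by
  rw [← (fiberMk I J).commutes, fiberMk_eq_zero_iff]
  intro x
  rw [algebraMap_smul]
  ext n
  rw [DirectSum.smul_apply, maximalIdeal_smul_eq_zero I _ hc, DirectSum.zero_apply]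

/-- Acting on the generator and projecting to finitely many components. -/
def reesEval (S : Finset (Fin r → ℕ)) :
    MultiRees I →ₗ[R] (∀ n : S, FiberPiece I (R ⧸ J) n) :=
  LinearMap.pi (fun n : S => DirectSum.component R _ (FiberPiece I (R ⧸ J)) n) ∘ₗ
    (LinearMap.toSpanSingleton (MultiRees I) _ (fiberOne I J)).restrictScalars R

theorem reesEval_apply (S : Finset (Fin r → ℕ)) (z : MultiRees I) (n : S) :
    reesEval I J S z n = (z • fiberOne I J) n := rfl

/-- Elements of the annihilator kill the generator, so evaluation at it descends to the fiber ring.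
-/
theorem exists_fiberEval (S : Finset (Fin r → ℕ)) :
    ∃ θ : FiberRing I J →ₗ[R] (∀ n : S, FiberPiece I (R ⧸ J) n),
      ∀ z, θ (fiberMk I J z) = reesEval I J S z := by
  have hs : Function.Surjective (fiberMk I J).toLinearMap := fiberMk_surjective I J
  refine ⟨Submodule.liftQ (fiberMk I J).toLinearMap.ker (reesEval I J S) (fun z hz => ?_) ∘ₗ
    ((fiberMk I J).toLinearMap.quotKerEquivOfSurjective hs).symm.toLinearMap, fun z => ?_⟩
  · ext n
    rw [reesEval_apply, (fiberMk_eq_zero_iff I J).1 hz]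
    rfl
  · have : ((fiberMk I J).toLinearMap.quotKerEquivOfSurjective hs).symm (fiberMk I J z) =
        Submodule.Quotient.mk z := by
      rw [LinearEquiv.symm_apply_eq]
      rfl
    rw [LinearMap.comp_apply, LinearEquiv.coe_coe, this]
    rfl

/-- The images in the fiber ring of the generators of the Rees ring. -/
def fiberVar {ι : Type*} {a : ι → R} {d : ι → Fin r}
    (hI : ∀ i, I i = Ideal.span (a '' {j | d j = i})) (j : ι) : FiberRing I J :=
  fiberMk I J (reesVar hI j)

theorem fiberMk_of_mem {ι : Type*} {a : ι → R} {d : ι → Fin r}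
    (hI : ∀ i, I i = Ideal.span (a '' {j | d j = i})) (n : Fin r → ℕ) (y : idealPow I n)
    (B : Submodule R (FiberRing I J))
    (hB : ∀ s : ι →₀ ℕ, s.degree = ∑ i, n i →
      aeval (fiberVar I J hI) (monomial s (1 : R)) ∈ B) :
    fiberMk I J (DirectSum.of (fun n => ↥(idealPow I n)) n y) ∈ B := by
  suffices h : reesMonomials hI (∑ i, n i) ≤ B.comap (fiberMk I J).toLinearMap from
    h (lof_mem_reesMonomials hI n y)
  refine Submodule.span_le.2 ?_
  rintro _ ⟨s, hs, rfl⟩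
  have : fiberMk I J (aeval (reesVar hI) (monomial s (1 : R))) =
      aeval (fiberVar I J hI) (monomial s (1 : R)) := by
    refine DFunLike.congr_fun (MvPolynomial.algHom_ext (f := (fiberMk I J).comp
      (aeval (reesVar hI))) (g := aeval (fiberVar I J hI)) fun j => ?_) _
    rw [AlgHom.comp_apply, aeval_X, aeval_X]
    rfl
  rw [SetLike.mem_coe, Submodule.mem_comap, AlgHom.toLinearMap_apply, this]
  exact hB s hs

theorem mem_span_range_monomials {ι : Type*} {a : ι → R} {d : ι → Fin r}
    (hI : ∀ i, I i = Ideal.span (a '' {j | d j = i})) (z : FiberRing I J) :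
    z ∈ Submodule.span R
      (Set.range fun s : ι →₀ ℕ => aeval (fiberVar I J hI) (monomial s (1 : R))) := by
  obtain ⟨z, rfl⟩ := fiberMk_surjective I J z
  induction z using DirectSum.induction_on with
  | zero => rw [map_zero]; exact zero_mem _
  | add z w h h' => rw [map_add]; exact add_mem h h'
  | of n z => exact fiberMk_of_mem I J hI n z _ fun s _ => Submodule.subset_span ⟨s, rfl⟩

/-- Each component of a target family is a homogeneous multiple of the generator. The sum of these
multipliers hits the whole family, since different multidegrees do not interact, and it involves
only monomials of degree at most `N`. -/
theorem span_image_fiberEval_eq_top {ι : Type*} {a : ι → R} {d : ι → Fin r}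
    (hI : ∀ i, I i = Ideal.span (a '' {j | d j = i})) {N : ℕ} {S : Finset (Fin r → ℕ)}
    (hS : ∀ n ∈ S, ∑ i, n i ≤ N) {G : Set (FiberRing I J)}
    (hG : ∀ s : ι →₀ ℕ, s.degree ≤ N →
      aeval (fiberVar I J hI) (monomial s (1 : R)) ∈ Submodule.span R G)
    {θ : FiberRing I J →ₗ[R] (∀ n : S, FiberPiece I (R ⧸ J) n)}
    (hθ : ∀ z, θ (fiberMk I J z) = reesEval I J S z) :
    Submodule.span R (θ '' G) = ⊤ := by
  rw [Submodule.span_image, eq_top_iff]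
  rintro f -
  choose b hb using fun n : S => exists_of_smul_fiberOne I J n (f n)
  refine ⟨∑ n : S, fiberMk I J (DirectSum.of (fun n => ↥(idealPow I n)) n (b n)), ?_, ?_⟩
  · exact Submodule.sum_mem _ fun n _ => fiberMk_of_mem I J hI _ _ _ fun s hs =>
      hG s (hs.le.trans (hS n n.2))
  · rw [map_sum]
    ext n
    rw [Finset.sum_apply, Finset.sum_eq_single n]
    · rw [hθ, reesEval_apply, hb, DirectSum.of_eq_same]
    · intro m _ hm
      rw [hθ, reesEval_apply, hb, DirectSum.of_eq_of_ne]
      exact fun h => hm (Subtype.ext h.symm)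
    · simp

/-- The lengths of the modules `𝐈ⁿ(R/J) / 𝔪𝐈ⁿ(R/J)`, summed over multidegrees of total degree
at most `N`, grow at most like a power of `N` with exponent the analytic spread. -/
theorem exists_sum_length_fiberPiece_le [IsNoetherianRing R] {D : ℕ}
    (hD : multiSpread I (R ⧸ J) ≤ D) :
    ∃ K : ℕ, ∀ (N : ℕ) (S : Finset (Fin r → ℕ)), (∀ n ∈ S, ∑ i, n i ≤ N) →
      ∑ n ∈ S, Module.length R (FiberPiece I (R ⧸ J) n) ≤ (K * (N + 1) ^ D : ℕ) := by
  classical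
  rw [multiSpread_eq_ringKrullDim_fiberRing] at hD
  obtain ⟨ι, _, a, d, hI⟩ := exists_generators I
  rcases subsingleton_or_nontrivial (FiberRing I J) with hF | hF
  · refine ⟨0, fun N S _ => ?_⟩
    rw [Finset.sum_eq_zero]
    · simp
    · intro n _
      rw [Module.length_eq_zero_iff, subsingleton_iff_forall_eq 0]
      intro x
      refine DirectSum.of_injective (β := FiberPiece I (R ⧸ J)) n ?_
      rw [map_zero, ← one_smul (MultiRees I) (DirectSum.of (FiberPiece I (R ⧸ J)) n x)]
      exact (fiberMk_eq_zero_iff I J).1 (Subsingleton.elim _ _) _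
  obtain ⟨c, hc⟩ := exists_finset_monomials_subset_span_of_isLocalRing
    (fun c hc => algebraMap_fiberRing_eq_zero I J hc) (fiberVar I J hI)
    (mem_span_range_monomials I J hI) hD
  refine ⟨c, fun N S hS => ?_⟩
  obtain ⟨G, hG, hGs⟩ := hc N
  obtain ⟨θ, hθ⟩ := exists_fiberEval I J S
  -- The sum of lengths is the length of a product killed by `𝔪` and spanned by the image of `G`.
  rw [← Finset.sum_coe_sort, ← Module.length_pi_of_fintype]
  refine (length_le_card_of_span_eq_top (fun c hc f => ?_) (G.image θ) ?_).trans ?_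
  · ext n
    exact maximalIdeal_smul_eq_zero I _ hc _
  · rw [Finset.coe_image]
    exact span_image_fiberEval_eq_top I J hI hS hGs hθ
  · exact_mod_cast Finset.card_image_le.trans hG

end Module

end Fiber

/-! ### Comparing lengths up to constant factors -/

section SubquotientBounds

variable {R : Type*} [CommRing R] {T : Type*} [AddCommGroup T] [Module R T]
  {T' : Type*} [AddCommGroup T'] [Module R T']

theorem subLen_sup_sup_le {X Y : Submodule R T} (hYX : Y ≤ X) (Z : Submodule R T) :
    subLen (X ⊔ Z) (Y ⊔ Z) ≤ subLen X Y := by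
  have h : X ⊔ Z = X ⊔ (Y ⊔ Z) := by rw [← sup_assoc, sup_eq_left.2 hYX]
  rw [h, subLen_sup]
  exact subLen_le_of_le inf_le_left le_rfl (le_inf hYX le_sup_left)

theorem subLen_sup_le {X Y X' Y' : Submodule R T} (hYX : Y ≤ X) (hYX' : Y' ≤ X') :
    subLen (X ⊔ X') (Y ⊔ Y') ≤ subLen X Y + subLen X' Y' := by
  rw [subLen_add (sup_le_sup_left hYX' Y) (sup_le_sup_right hYX X')]
  refine add_le_add (subLen_sup_sup_le hYX X') ?_
  rw [sup_comm Y X', sup_comm Y Y']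
  exact subLen_sup_sup_le hYX' Y

theorem subLen_iSup_map_le {κ : Type*} (s : Finset κ) (f : κ → T →ₗ[R] T') {A B : Submodule R T}
    (hBA : B ≤ A) :
    subLen (⨆ i ∈ s, A.map (f i)) (⨆ i ∈ s, B.map (f i)) ≤ s.card * subLen A B := by
  classical
  induction s using Finset.induction_on with
  | empty => simp [subLen_self]
  | insert i s hi ih =>
    rw [Finset.iSup_insert, Finset.iSup_insert, Finset.card_insert_of_notMem hi]
    refine (subLen_sup_le (Submodule.map_mono hBA)
      (iSup₂_mono fun i _ => Submodule.map_mono hBA)).trans ?_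
    refine (add_le_add (subLen_map_le (f i) hBA) ih).trans ?_
    push_cast
    rw [add_mul, one_mul, add_comm]

theorem span_smul_eq_iSup_map (s : Finset R) (A : Submodule R T) :
    Ideal.span (s : Set R) • A = ⨆ y ∈ s, A.map (LinearMap.lsmul R T y) := by
  refine le_antisymm (Submodule.smul_le.2 fun a ha x hx => ?_) (iSup₂_le fun y hy => ?_)
  · induction ha using Submodule.span_induction with
    | mem y hy =>
      exact Submodule.mem_iSup_of_mem y (Submodule.mem_iSup_of_mem hy ⟨x, hx, rfl⟩)
    | zero => rw [zero_smul]; exact zero_mem _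
    | add a b _ _ h h' => rw [add_smul]; exact add_mem h h'
    | smul c a _ h => rw [smul_assoc]; exact Submodule.smul_mem _ _ h
  · rintro _ ⟨x, hx, rfl⟩
    exact Submodule.smul_mem_smul (Ideal.subset_span hy) hx

/-- The length of `A / 𝔪ᵏA` is bounded by a constant multiple of that of `A / 𝔪A`. -/
theorem exists_subLen_pow_smul_le_mul [IsNoetherianRing R] (𝔪 : Ideal R) (k : ℕ) :
    ∃ K : ℕ, ∀ A : Submodule R T, subLen A (𝔪 ^ k • A) ≤ K * subLen A (𝔪 • A) := by
  induction k with
  | zero => exact ⟨0, fun A => by simp [subLen_self]⟩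
  | succ k ih =>
    obtain ⟨K, hK⟩ := ih
    obtain ⟨s, hs⟩ : (𝔪 ^ k).FG := IsNoetherian.noetherian _
    refine ⟨K + s.card, fun A => ?_⟩
    have h1 : 𝔪 ^ (k + 1) • A = 𝔪 ^ k • 𝔪 • A := by rw [pow_succ, mul_smul]
    rw [h1, subLen_add (Submodule.smul_mono le_rfl Submodule.smul_le_right)
      Submodule.smul_le_right]
    push_cast
    rw [add_mul]
    -- The remaining layer `𝔪ᵏA / 𝔪ᵏ⁺¹A` is a sum of images of `A / 𝔪A`, one for each generator of
    -- `𝔪ᵏ`.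
    refine add_le_add (hK A) ?_
    rw [← hs]
    change subLen (Ideal.span _ • _) (Ideal.span _ • _) ≤ _
    rw [span_smul_eq_iSup_map, span_smul_eq_iSup_map]
    exact subLen_iSup_map_le _ _ Submodule.smul_le_right

theorem smul_submoduleOf (𝔞 : Ideal R) (A : Submodule R T) :
    (𝔞 • A).submoduleOf A = 𝔞 • (⊤ : Submodule R A) := by
  have h : (𝔞 • (⊤ : Submodule R A)).map A.subtype = 𝔞 • A := by
    rw [Submodule.map_smul'', Submodule.map_subtype_top]
  rw [← h, Submodule.submoduleOf, Submodule.comap_map_eq_of_injective A.subtype_injective]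

theorem subLen_smul_eq (𝔞 : Ideal R) (A : Submodule R T) :
    subLen A (𝔞 • A) = Module.length R (↥A ⧸ 𝔞 • (⊤ : Submodule R A)) := by
  rw [subLen, smul_submoduleOf]

/-- If `V` is annihilated by `J`, then the length of `𝔞V / 𝔟V` is bounded by a constant multiple of
that of `𝔞(R/J) / 𝔟(R/J)`. -/
theorem exists_subLen_smul_le_mul {V : Submodule R T} (hV : V.FG) {J : Ideal R}
    (hJ : J ≤ V.annihilator) :
    ∃ K : ℕ, ∀ 𝔞 𝔟 : Ideal R, 𝔟 ≤ 𝔞 → subLen (𝔞 • V) (𝔟 • V) ≤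
      K * subLen (𝔞 • (⊤ : Submodule R (R ⧸ J))) (𝔟 • (⊤ : Submodule R (R ⧸ J))) := by
  classical
  obtain ⟨s, hs⟩ := hV
  have hmem : ∀ v : s, (v : T) ∈ V := fun v => hs ▸ Submodule.subset_span v.2
  -- Since `J` kills `V`, each generator `v` gives a map `R/J → T` with `1 ↦ v`, and `𝔞V` is the sum
  -- of the images of `𝔞(R/J)`.
  let f : s → (R ⧸ J) →ₗ[R] T := fun v => Submodule.liftQ J (LinearMap.toSpanSingleton R T v)
    fun c hc => LinearMap.mem_ker.2 (Submodule.mem_annihilator.1 (hJ hc) v (hmem v))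
  have hf : ∀ 𝔞 : Ideal R, 𝔞 • V =
      ⨆ v ∈ (Finset.univ : Finset s), (𝔞 • (⊤ : Submodule R (R ⧸ J))).map (f v) := by
    intro 𝔞
    have hV : V = ⨆ v : s, (⊤ : Submodule R (R ⧸ J)).map (f v) := by
      refine le_antisymm ?_ (iSup_le ?_)
      · rw [← hs, Submodule.span_le]
        intro v hv
        exact Submodule.mem_iSup_of_mem ⟨v, hv⟩
          ⟨Submodule.Quotient.mk 1, trivial, one_smul R v⟩
      · rintro v _ ⟨x, -, rfl⟩
        obtain ⟨x, rfl⟩ := Submodule.Quotient.mk_surjective _ x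
        exact V.smul_mem x (hmem v)
    conv_lhs => rw [hV]
    simp only [Submodule.smul_iSup, Submodule.map_smul'', Finset.mem_univ, iSup_pos]
  refine ⟨(Finset.univ : Finset s).card, fun 𝔞 𝔟 h => ?_⟩
  rw [hf 𝔞, hf 𝔟]
  exact subLen_iSup_map_le _ _ (Submodule.smul_mono_left h)

end SubquotientBounds

/-! ### Comparing degrees through eventual inequalities -/

section PolynomialGrowth

open Filter MvPolynomial

variable {σ : Type*} [Fintype σ] [DecidableEq σ]

theorem eq_zero_of_eventually_natEval_eq_zero {P : MvPolynomial σ ℚ}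
    (h : ∀ᶠ n : σ → ℕ in atTop, natEval n P = 0) : P = 0 := by
  obtain ⟨c, hc⟩ := eventually_atTop.1 h
  refine MvPolynomial.funext_set (fun i => Set.range fun k : ℕ => ((c i + k : ℕ) : ℚ))
    (fun i => Set.infinite_range_of_injective fun a b hab => by simpa using hab) fun x hx => ?_
  choose a ha using fun i => hx i trivial
  rw [map_zero, ← hc (fun i => c i + a i) fun i => Nat.le_add_right _ _, natEval]
  exact congrArg (fun y => eval y P) (funext fun i => (ha i).symm)

/-- Each variable is at most `1 + |n|`, and the added `1` makes powers of this base increase with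
the exponent, so every monomial is dominated by the top power. -/
theorem exists_abs_natEval_le (P : MvPolynomial σ ℚ) :
    ∃ K : ℚ, ∀ n : σ → ℕ, |natEval n P| ≤ K * (1 + ∑ i, (n i : ℚ)) ^ P.totalDegree := by
  refine ⟨∑ s ∈ P.support, |coeff s P|, fun n => ?_⟩
  rw [natEval, eval_eq', Finset.sum_mul]
  refine (Finset.abs_sum_le_sum_abs _ _).trans (Finset.sum_le_sum fun s hs => ?_)
  have h0 : (0 : ℚ) ≤ ∑ i, (n i : ℚ) := by positivity
  rw [abs_mul]
  refine mul_le_mul_of_nonneg_left ?_ (abs_nonneg _)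
  rw [abs_of_nonneg (by positivity)]
  calc ∏ i, (n i : ℚ) ^ s i ≤ ∏ i, (1 + ∑ i, (n i : ℚ)) ^ s i := by
        refine Finset.prod_le_prod (fun _ _ => by positivity) fun i _ => ?_
        refine pow_le_pow_left₀ (by positivity) ?_ _
        have := Finset.single_le_sum (f := fun i => (n i : ℚ)) (fun _ _ => by positivity)
          (Finset.mem_univ i)
        linarith
    _ = (1 + ∑ i, (n i : ℚ)) ^ (∑ i, s i) := by rw [Finset.prod_pow_eq_pow_sum]
    _ ≤ _ := by
        refine pow_le_pow_right₀ (by linarith) ?_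
        have := le_totalDegree hs
        rwa [Finsupp.sum_fintype _ _ (fun _ => rfl)] at this

theorem totalDegree_le_of_eventually_le {P Q : MvPolynomial σ ℚ} {K : ℚ} (hK : 0 ≤ K)
    (h : ∀ᶠ n : σ → ℕ in atTop, |natEval n P| ≤ K * |natEval n Q|) :
    P.totalDegree ≤ Q.totalDegree := by
  obtain ⟨K', hK'⟩ := exists_abs_natEval_le Q
  refine totalDegree_le_of_growth (K := K * K') ?_
  filter_upwards [h] with n hn
  rw [mul_assoc]
  exact hn.trans (mul_le_mul_of_nonneg_left (hK' n) hK)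

end PolynomialGrowth

/-! ### The degree bound by the analytic spread -/

section FiberDegree

open Filter IsLocalRing

variable {R : Type*} [CommRing R] [IsNoetherianRing R] {r : ℕ} (I : Fin r → Ideal R)

theorem smul_idealPow_smul_le {T : Type*} [AddCommGroup T] [Module R T] (V : Submodule R T)
    (n : Fin r → ℕ) (i : Fin r) :
    I i • idealPow I n • V ≤ idealPow I (n + Pi.single i 1) • V := by
  rw [← mul_smul, idealPow_add, idealPow_single, mul_comm]

theorem idealPow_antitone : Antitone (idealPow I) := fun m n hmn => by
  obtain ⟨l, rfl⟩ := exists_add_of_le hmn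
  exact (idealPow_add I m l).trans_le Ideal.mul_le_left

variable [IsLocalRing R] (J : Ideal R)

theorem length_fiberPiece_eq (n : Fin r → ℕ) :
    Module.length R (FiberPiece I (R ⧸ J) n) = subLen (idealPow I n • (⊤ : Submodule R (R ⧸ J)))
      (maximalIdeal R • idealPow I n • (⊤ : Submodule R (R ⧸ J))) :=
  (subLen_smul_eq _ _).symm

theorem length_fiberPiece_ne_top (n : Fin r → ℕ) :
    Module.length R (FiberPiece I (R ⧸ J) n) ≠ ⊤ := by
  rw [length_fiberPiece_eq]
  exact subLen_ne_top_of_pow_smul_le (IsNoetherian.noetherian _) (k := 1) (by rw [pow_one])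

/-- The Hilbert polynomial of the multigraded fiber of `R/J`, whose degree plus the number of
ideals is at most the analytic spread. -/
theorem exists_fiber_polynomial : ∃ Q : MvPolynomial (Fin r) ℚ,
    (∀ᶠ n in atTop, ((Module.length R (FiberPiece I (R ⧸ J) n)).toNat : ℚ) = natEval n Q) ∧
    (Q ≠ 0 → ∀ D : ℕ, multiSpread I (R ⧸ J) ≤ D → Q.totalDegree + r ≤ D) := by
  obtain ⟨Q, hQ⟩ : EvPoly fun n => ((Module.length R (FiberPiece I (R ⧸ J) n)).toNat : ℚ) := by
    simp_rw [length_fiberPiece_eq]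
    refine evPoly_subLen_of_smul_le I (V := ⊤) (IsNoetherian.noetherian _)
      (smul_idealPow_smul_le I _) (fun n i => ?_) (fun n => Submodule.smul_le_right)
      (fun n => le_rfl) (Eventually.of_forall fun n => ?_)
    · rw [smul_comm]
      exact Submodule.smul_mono le_rfl (smul_idealPow_smul_le I _ n i)
    · rw [← length_fiberPiece_eq]
      exact length_fiberPiece_ne_top I J n
  refine ⟨Q, hQ, fun hQ0 D hD => ?_⟩
  obtain ⟨c, hc⟩ := eventually_atTop.1 hQ
  obtain ⟨K, hK⟩ := exists_sum_length_fiberPiece_le I J hD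
  -- Only the sums of lengths are controlled by `D`; comparing their growth with that of box sums of
  -- `Q` gains the summand `r`.
  have := totalDegree_add_card_le_of_growth_sum (K := (K : ℚ)) (D := D) (c := c) hQ0 fun n _ => ?_
  · rwa [Fintype.card_fin] at this
  have h1 : ∑ m ∈ partialBox Finset.univ c n, natEval m Q =
      ((∑ m ∈ partialBox Finset.univ c n,
        (Module.length R (FiberPiece I (R ⧸ J) m)).toNat : ℕ) : ℚ) := by
    push_cast
    refine Finset.sum_congr rfl fun m hm => (hc m fun i => ?_).symm
    exact ((mem_partialBox.1 hm i).1 (Finset.mem_univ i)).1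
  have h2 := hK (∑ i, n i) (partialBox Finset.univ c n) fun m hm =>
    Finset.sum_le_sum fun i _ => ((mem_partialBox.1 hm i).1 (Finset.mem_univ i)).2.le
  have h3 : ∑ m ∈ partialBox Finset.univ c n, Module.length R (FiberPiece I (R ⧸ J) m) =
      ((∑ m ∈ partialBox Finset.univ c n,
        (Module.length R (FiberPiece I (R ⧸ J) m)).toNat : ℕ) : ℕ∞) := by
    push_cast
    exact Finset.sum_congr rfl fun m _ => (ENat.natCast_toNat (length_fiberPiece_ne_top I J m)).symm
  rw [h3, Nat.cast_le] at h2
  rw [h1, abs_of_nonneg (Nat.cast_nonneg _)]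
  have h4 : ((K * (∑ i, n i + 1) ^ D : ℕ) : ℚ) = K * (1 + ∑ i, (n i : ℚ)) ^ D := by
    push_cast; rw [add_comm]
  rw [← h4]
  exact_mod_cast h2

variable {T : Type*} [AddCommGroup T] [Module R T]

/-- The lengths of `𝐈ⁿV / 𝐈ⁿW` are bounded by a multiple of those of the fiber of `R/J`. -/
theorem exists_subLen_idealPow_le {V W : Submodule R T} (hV : V.FG) (hWV : W ≤ V) {J : Ideal R}
    (hJ : J ≤ V.annihilator)
    (hfin : ∀ᶠ n in atTop, subLen (idealPow I n • V) (idealPow I n • W) ≠ ⊤) :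
    ∃ K : ℕ, ∀ᶠ n in atTop, subLen (idealPow I n • V) (idealPow I n • W) ≤
      K * Module.length R (FiberPiece I (R ⧸ J) n) := by
  obtain ⟨c, hc⟩ := eventually_atTop.1 hfin
  obtain ⟨k, hk⟩ := exists_pow_smul_le_of_subLen_ne_top (hc c le_rfl)
  obtain ⟨K₁, hK₁⟩ := exists_subLen_smul_le_mul hV hJ
  obtain ⟨K₂, hK₂⟩ := exists_subLen_pow_smul_le_mul (T := R ⧸ J) (maximalIdeal R) k
  refine ⟨K₁ * K₂, eventually_atTop.2 ⟨c, fun n hn => ?_⟩⟩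
  -- The containment at the single multidegree `c` propagates to every larger `n` on multiplying by
  -- `𝐈ⁿ⁻ᶜ`, so one exponent `k` serves them all.
  have hle : (maximalIdeal R ^ k * idealPow I n) • V ≤ idealPow I n • W := by
    obtain ⟨l, rfl⟩ := exists_add_of_le hn
    have h : maximalIdeal R ^ k * idealPow I (c + l) =
        idealPow I l * (maximalIdeal R ^ k * idealPow I c) := by rw [idealPow_add]; ring
    have h' : idealPow I (c + l) = idealPow I l * idealPow I c := by rw [idealPow_add, mul_comm]
    rw [h, h', mul_smul (idealPow I l), mul_smul (idealPow I l), mul_smul (maximalIdeal R ^ k)]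
    exact Submodule.smul_mono le_rfl hk
  have h1 := subLen_le_of_le (Submodule.smul_mono le_rfl hWV) le_rfl hle
  have h2 := hK₁ (idealPow I n) (maximalIdeal R ^ k * idealPow I n) Ideal.mul_le_right
  have h3 := hK₂ (idealPow I n • ⊤)
  rw [← mul_smul (maximalIdeal R ^ k), ← length_fiberPiece_eq] at h3
  refine h1.trans (h2.trans ((mul_le_mul_right h3 _).trans_eq ?_))
  rw [Nat.cast_mul, mul_assoc]

end FiberDegree

/-! ### The intersections of `U` with `𝐈ⁿV` -/

section InfPolynomial

open Filter IsLocalRing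

variable {R : Type*} [CommRing R] [IsNoetherianRing R] {r : ℕ} (I : Fin r → Ideal R)
  {T : Type*} [AddCommGroup T] [Module R T] {U V W : Submodule R T}

theorem smul_inf_idealPow_smul_le (U V : Submodule R T) (n : Fin r → ℕ) (i : Fin r) :
    I i • (U ⊓ idealPow I n • V) ≤ U ⊓ idealPow I (n + Pi.single i 1) • V :=
  le_inf (Submodule.smul_le_right.trans inf_le_left)
    ((Submodule.smul_mono le_rfl inf_le_right).trans (smul_idealPow_smul_le I V n i))

theorem inf_idealPow_smul_antitone (U V : Submodule R T) :
    Antitone fun n : Fin r → ℕ => U ⊓ idealPow I n • V := fun _ _ h =>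
  inf_le_inf_left U (Submodule.smul_mono_left (idealPow_antitone I h))

/-- The lengths of `U / (U ∩ 𝐈ⁿV)` are eventually polynomial. -/
theorem evPoly_subLen_inf (hV : V.FG)
    (hfin : ∀ᶠ n in atTop, subLen U (U ⊓ idealPow I n • V) ≠ ⊤) :
    EvPoly fun n => ((subLen U (U ⊓ idealPow I n • V)).toNat : ℚ) := by
  have hadd : ∀ n i, subLen U (U ⊓ idealPow I (n + Pi.single i 1) • V) =
      subLen U (U ⊓ idealPow I n • V) +
        subLen (U ⊓ idealPow I n • V) (U ⊓ idealPow I (n + Pi.single i 1) • V) := fun n i =>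
    subLen_add (inf_idealPow_smul_antitone I U V le_self_add) inf_le_left
  obtain ⟨c, hc⟩ := eventually_atTop.1 hfin
  have hfin' : ∀ n i, c ≤ n →
      subLen (U ⊓ idealPow I n • V) (U ⊓ idealPow I (n + Pi.single i 1) • V) ≠ ⊤ := by
    intro n i hn h
    refine hc (n + Pi.single i 1) (hn.trans le_self_add) ?_
    rw [hadd, h, add_top]
  refine EvPoly.of_differences fun i => ?_
  refine EvPoly.congr (evPoly_subLen_of_smul_le I hV (A := fun n => U ⊓ idealPow I n • V)
    (B := fun n => U ⊓ idealPow I (n + Pi.single i 1) • V) (smul_inf_idealPow_smul_le I U V)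
    (fun n j => ?_) (fun n => inf_idealPow_smul_antitone I U V le_self_add)
    (fun n => inf_le_right) (eventually_atTop.2 ⟨c, fun n hn => hfin' n i hn⟩)) ?_
  · rw [add_right_comm]
    exact smul_inf_idealPow_smul_le I U V _ j
  · refine eventually_atTop.2 ⟨c, fun n hn => ?_⟩
    rw [hadd, ENat.toNat_add (hc n hn) (hfin' n i hn)]
    push_cast
    ring

/-- As `U' ≤ U`, the containment can be fed back into itself, each factor `𝔪ᵏ` gaining another
factor `𝐈^(M,…,M)`. -/
theorem pow_smul_le_idealPow_smul {𝔪 : Ideal R} {U U' : Submodule R T} (hU : U' ≤ U) {k M : ℕ}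
    (h : 𝔪 ^ k • U ≤ idealPow I (fun _ => M) • U') (N : ℕ) :
    𝔪 ^ (k * (N + 1)) • U ≤ idealPow I (fun _ => (N + 1) * M) • U' := by
  induction N with
  | zero => simpa using h
  | succ N ih =>
    have h1 : 𝔪 ^ (k * (N + 1 + 1)) = 𝔪 ^ k * 𝔪 ^ (k * (N + 1)) := by
      rw [← pow_add]; ring_nf
    have h2 : idealPow I (fun _ => (N + 1 + 1) * M) =
        idealPow I (fun _ => (N + 1) * M) * idealPow I (fun _ => M) := by
      rw [← idealPow_add]
      exact congrArg _ (funext fun _ => by simp [add_mul])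
    rw [h1, h2, mul_smul, mul_smul]
    calc 𝔪 ^ k • 𝔪 ^ (k * (N + 1)) • U ≤ 𝔪 ^ k • idealPow I (fun _ => (N + 1) * M) • U :=
          Submodule.smul_mono le_rfl (ih.trans (Submodule.smul_mono le_rfl hU))
      _ = idealPow I (fun _ => (N + 1) * M) • 𝔪 ^ k • U := smul_comm _ _ _
      _ ≤ _ := Submodule.smul_mono le_rfl h

/-- The lengths of `U / (U ∩ 𝐈ⁿV)` grow at most like a polynomial of degree `dim U`. -/
theorem exists_subLen_inf_le [IsLocalRing R] (hU : U.FG) (hV : V.FG)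
    (hfin : ∀ᶠ n in atTop, subLen U (U ⊓ idealPow I n • V) ≠ ⊤) {d : ℕ}
    (hd : Module.supportDim R U ≤ d) :
    ∃ K : ℕ, ∀ᶠ n in atTop, subLen U (U ⊓ idealPow I n • V) ≤ (K * (∑ i, n i + 1) ^ d : ℕ) := by
  obtain ⟨c, hc⟩ := exists_le_smul_of_smul_le I hV (smul_inf_idealPow_smul_le I U V)
    fun n => inf_le_right
  obtain ⟨b, hb⟩ := eventually_atTop.1 hfin
  -- `M` exceeds every `bᵢ`, giving finite length at `c + (M,…,M)`; being at least `1`, it also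
  -- makes `(N + 1) * M` exceed every `nᵢ`.
  set M := ∑ i, b i + 1
  have hbM : b ≤ c + fun _ => M := fun i =>
    (Finset.single_le_sum (fun _ _ => Nat.zero_le _) (Finset.mem_univ i)).trans
      ((Nat.le_succ _).trans (Nat.le_add_left _ _))
  obtain ⟨k, hk⟩ := exists_pow_smul_le_of_subLen_ne_top (hb _ hbM)
  rw [hc] at hk
  have : Module.Finite R U := Module.Finite.iff_fg.2 hU
  obtain ⟨K, hK⟩ := exists_subLen_pow_smul_le hd
  refine ⟨K * (k + 1) ^ d, eventually_atTop.2 ⟨0, fun n _ => ?_⟩⟩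
  set N := ∑ i, n i
  have hle : maximalIdeal R ^ (k * (N + 1)) • U ≤ U ⊓ idealPow I n • V := by
    refine (pow_smul_le_idealPow_smul I inf_le_left hk N).trans ?_
    rw [← hc]
    refine inf_idealPow_smul_antitone I U V fun i => ?_
    have : n i ≤ N := Finset.single_le_sum (fun _ _ => Nat.zero_le _) (Finset.mem_univ i)
    calc n i ≤ (N + 1) * 1 := by omega
      _ ≤ (N + 1) * M := Nat.mul_le_mul_left _ (Nat.le_add_left _ _)
      _ ≤ c i + (N + 1) * M := Nat.le_add_left _ _
  refine (subLen_le_of_le inf_le_left le_rfl hle).trans ?_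
  rw [subLen_smul_eq, ← subLen_top]
  refine (hK _).trans (Nat.cast_le.2 ?_)
  rw [mul_assoc, ← mul_pow]
  refine Nat.mul_le_mul_left _ (Nat.pow_le_pow_left ?_ _)
  nlinarith

end InfPolynomial

/-! ### Degree bounds for the two summands -/

section DegreeBounds

open Filter IsLocalRing

variable {R : Type u} [CommRing R] [IsNoetherianRing R] {r : ℕ} (I : Fin r → Ideal R)
  {T : Type v} [AddCommGroup T] [Module R T] {U V W : Submodule R T}

theorem totalDegree_le_supportDim [IsLocalRing R] (hU : U.FG) (hV : V.FG)
    (hfin : ∀ᶠ n in atTop, subLen U (U ⊓ idealPow I n • V) ≠ ⊤) {P : MvPolynomial (Fin r) ℚ}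
    (hP : ∀ᶠ n in atTop, ((subLen U (U ⊓ idealPow I n • V)).toNat : ℚ) = natEval n P)
    (hP0 : P ≠ 0) : (P.totalDegree : WithBot ℕ∞) ≤ Module.supportDim R U := by
  have key : ∀ d : ℕ, Module.supportDim R U ≤ d → P.totalDegree ≤ d := by
    intro d hd
    obtain ⟨K, hK⟩ := exists_subLen_inf_le I hU hV hfin hd
    refine totalDegree_le_of_growth (K := K) ?_
    filter_upwards [hP, hK] with n h1 h2
    rw [← h1, abs_of_nonneg (Nat.cast_nonneg _)]
    have := ENat.toNat_le_toNat h2 (ENat.natCast_ne_top _)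
    rw [ENat.toNat_natCast] at this
    have h : ((subLen U (U ⊓ idealPow I n • V)).toNat : ℚ) ≤ (K * (∑ i, n i + 1) ^ d : ℕ) :=
      Nat.cast_le.2 this
    refine h.trans_eq ?_
    push_cast
    rw [add_comm]
  rcases subsingleton_or_nontrivial U with hs | hs
  · refine (hP0 (eq_zero_of_eventually_natEval_eq_zero ?_)).elim
    filter_upwards [hP] with n h1
    rw [← h1, subLen, Module.length_eq_zero, ENat.toNat_zero, Nat.cast_zero]
  · have hbot : Module.supportDim R U ≠ ⊥ := Module.supportDim_ne_bot_of_nontrivial R U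
    obtain ⟨e, he⟩ := WithBot.ne_bot_iff_exists.1 hbot
    rw [← he] at key ⊢
    induction e using ENat.recTopCoe with
    | top => exact le_top
    | coe d => exact_mod_cast key d le_rfl

theorem totalDegree_add_le_multiSpread [IsLocalRing R] (hr : 1 ≤ r) (hV : V.FG) (hWV : W ≤ V)
    {J : Ideal R} (hJ : J ≤ V.annihilator)
    (hfin : ∀ᶠ n in atTop, subLen (idealPow I n • V) (idealPow I n • W) ≠ ⊤)
    {P : MvPolynomial (Fin r) ℚ}
    (hP : ∀ᶠ n in atTop, ((subLen (idealPow I n • V) (idealPow I n • W)).toNat : ℚ) = natEval n P)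
    (hP0 : P ≠ 0) : (P.totalDegree : WithBot ℕ∞) + r ≤ multiSpread I (R ⧸ J) := by
  obtain ⟨K, hK⟩ := exists_subLen_idealPow_le I hV hWV hJ hfin
  obtain ⟨Q, hQ, hQdeg⟩ := exists_fiber_polynomial I J
  have hPQ : ∀ᶠ n : Fin r → ℕ in atTop, |natEval n P| ≤ (K : ℚ) * |natEval n Q| := by
    filter_upwards [hP, hK, hQ] with n h1 h2 h3
    rw [← h1, ← h3, Nat.abs_cast, Nat.abs_cast, ← Nat.cast_mul, Nat.cast_le]
    have h := ENat.toNat_le_toNat h2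
      (WithTop.mul_ne_top (ENat.natCast_ne_top K) (length_fiberPiece_ne_top I J n))
    rwa [ENat.toNat_mul, ENat.toNat_natCast] at h
  have hQ0 : Q ≠ 0 := by
    rintro rfl
    refine hP0 (eq_zero_of_eventually_natEval_eq_zero ?_)
    filter_upwards [hPQ] with n h
    simpa [natEval] using h
  have hdeg := totalDegree_le_of_eventually_le (Nat.cast_nonneg K) hPQ
  have key : ∀ D : ℕ, multiSpread I (R ⧸ J) ≤ D → P.totalDegree + r ≤ D := fun D hD =>
    (Nat.add_le_add_right hdeg r).trans (hQdeg hQ0 D hD)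
  generalize multiSpread I (R ⧸ J) = e at key ⊢
  induction e using WithBot.recBotCoe with
  -- A spread of `-∞` would force `deg P + r ≤ 0`, contradicting `r ≥ 1`.
  | bot => have := key 0 bot_le; omega
  | coe e =>
    induction e using ENat.recTopCoe with
    | top => exact le_top
    | coe d => exact_mod_cast key d le_rfl

theorem totalDeg_eq {P : MvPolynomial (Fin r) ℚ} (hP : P ≠ 0) :
    totalDeg P = (P.totalDegree : WithBot ℕ∞) := by
  refine le_antisymm (Finset.sup_le fun s hs => ?_) ?_
  · exact_mod_cast MvPolynomial.le_totalDegree hs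
  · obtain ⟨s, hs, hsd⟩ := P.support.exists_mem_eq_sup (MvPolynomial.support_nonempty.2 hP)
      fun s => s.sum fun _ e => e
    rw [MvPolynomial.totalDegree, hsd]
    exact Finset.le_sup (f := fun s : Fin r →₀ ℕ => ((s.degree : ℕ) : WithBot ℕ∞)) hs

theorem totalDeg_add_le (P Q : MvPolynomial (Fin r) ℚ) :
    totalDeg (P + Q) ≤ max (totalDeg P) (totalDeg Q) := by
  classical
  refine (Finset.sup_mono MvPolynomial.support_add).trans ?_
  rw [Finset.sup_union]
  exact le_rfl

end DegreeBounds

end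

/-! ### The main theorem -/

theorem theorem2p6 {R : Type*} [CommRing R] [IsNoetherianRing R]
    {r : ℕ} (hr : 1 ≤ r) (I : Fin r → Ideal R)
    {T : Type*} [AddCommGroup T] [Module R T]
    (U V W : Submodule R T) (hU : U.FG) (hV : V.FG) (hW : W.FG) (hWV : W ≤ V)
    (hfin : ∃ c : Fin r → ℕ, ∀ n : Fin r → ℕ, c ≤ n →
      Module.length R (LModule I U V W n) ≠ ⊤) :
    ∃ P : MvPolynomial (Fin r) ℚ,
      (∃ c : Fin r → ℕ, ∀ n : Fin r → ℕ, c ≤ n →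
        ∃ k : ℕ, Module.length R (LModule I U V W n) = (k : ℕ∞) ∧
          (k : ℚ) = MvPolynomial.eval (fun i => (n i : ℚ)) P) ∧
      ∀ (_ : IsLocalRing R) (J : Ideal R), J ≤ V.annihilator →
        -- this is `deg P ≤ max {dim U, ℓ - r}`, with `r` added on both sides to avoid subtraction
        totalDeg P + (r : WithBot ℕ∞) ≤
          max (Module.supportDim R U + (r : WithBot ℕ∞)) (multiSpread I (R ⧸ J)) := by
  -- Additivity along `U + 𝐈ⁿV ⊇ 𝐈ⁿV ⊇ 𝐈ⁿW`, with the upper layer rewritten by the second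
  -- isomorphism theorem.
  have hlen : ∀ n, Module.length R (LModule I U V W n) =
      subLen U (U ⊓ idealPow I n • V) + subLen (idealPow I n • V) (idealPow I n • W) := fun n => by
    rw [← subLen_sup]
    exact subLen_add (Submodule.smul_mono le_rfl hWV) le_sup_right
  obtain ⟨c, hc⟩ := hfin
  simp only [hlen, ne_eq, ENat.add_eq_top, not_or] at hc
  have hfin₁ : ∀ᶠ n in Filter.atTop, subLen U (U ⊓ idealPow I n • V) ≠ ⊤ :=
    Filter.eventually_atTop.2 ⟨c, fun n hn => (hc n hn).1⟩
  have hfin₂ : ∀ᶠ n in Filter.atTop, subLen (idealPow I n • V) (idealPow I n • W) ≠ ⊤ :=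
    Filter.eventually_atTop.2 ⟨c, fun n hn => (hc n hn).2⟩
  obtain ⟨P, hP⟩ := evPoly_subLen_inf I hV hfin₁
  obtain ⟨Q, hQ⟩ := evPoly_subLen_of_smul_le I hV (smul_idealPow_smul_le I V)
    (smul_idealPow_smul_le I W) (fun n => Submodule.smul_mono le_rfl hWV) (fun n => le_rfl) hfin₂
  -- Both polynomials are fixed before `J` enters, so a single one satisfies the bound for every
  -- `J`.
  refine ⟨P + Q, ?_, fun _ J hJ => ?_⟩
  · refine Filter.eventually_atTop.1 ?_
    filter_upwards [hP, hQ, hfin₁, hfin₂] with n h1 h2 h3 h4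
    refine ⟨(subLen U (U ⊓ idealPow I n • V)).toNat +
      (subLen (idealPow I n • V) (idealPow I n • W)).toNat, ?_, ?_⟩
    · rw [hlen, Nat.cast_add, ENat.natCast_toNat h3, ENat.natCast_toNat h4]
    · rw [Nat.cast_add, h1, h2, map_add]
      rfl
  · refine (add_le_add_left (totalDeg_add_le P Q) _).trans ?_
    rw [max_add]
    refine max_le_max ?_ ?_
    · rcases eq_or_ne P 0 with rfl | hP0
      · simp [totalDeg]
      · rw [totalDeg_eq hP0]
        exact add_le_add_left (totalDegree_le_supportDim I hU hV hfin₁ hP hP0) _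
    · rcases eq_or_ne Q 0 with rfl | hQ0
      · simp [totalDeg]
      · rw [totalDeg_eq hQ0]
        exact totalDegree_add_le_multiSpread I hr hV hWV hJ hfin₂ hQ hQ0
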